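/- Let $G=(V_a\cup V_g,E)$ be a finite bipartite graph with at least one edge, $E\subseteq V_a\times V_g$, whose vertex set $V_a=\mathcal V_1\sqcup\dots\sqcup\mathcal V_{N_a}$ is partitioned into $N_a$ nonempty classes (one for each UAV), with real edge costs $c_{ij}$ and real edge weights $a_{ij}$, and let $B,\lambda\in\mathbb R$. Write $V=V_a\cup V_g$. Consider the Lagrangian relaxation (Problem 2) $$\min\ \sum_{(i,j)\in E} c_{ij}x_{ij}+\lambda\Big(\sum_{(i,j)\in E}a_{ij}x_{ij}-B\Big)$$ subject to $\sum_{(i,j)\in E,\ i\in\mathcal V_r}x_{ij}=1$ for all $r\in[N_a]$, $\ \sum_{i:(i,j)\in E}x_{ij}\le 1$ for all $j\in V_g$, and $x_{ij}\in\{0,1\}$ for all $(i,j)\in E$. **(a)** Problem 2 reduces to an integral min-cost network flow problem. Let $N$ be the network with nodes $s$, $q$, $v_1,\dots,v_{N_a}$ and $V$, with the arcs $s\to v_r$ ($r\in[N_a]$), $v_r\to i$ ($i\in\mathcal V_r$), $i\to j$ ($(i,j)\in E$) and $j\to q$ ($j\in V_g$), all of capacity one, where the arc of $(i,j)\in E$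 costs $c_{ij}+\lambda a_{ij}$ and all other arcs cost zero. Restricting a flow to the arcs of $E$ is a bijection from the integral $s$–$q$ flows of value $N_a$ in $N$ onto the feasible solutions of Problem 2, and the objective value of the solution is the cost of the flow minus $\lambda B$. (This part also holds if $E$ is empty.) **(b)** Problem 2 is solvable in $$O\big(|E|\,\log|V|\,(|E|+|V|\log|V|)\big)$$ time. That is, there are a constant $C$ and one algorithm for a random access machine that performs each arithmetic operation ($+,-,\times$) and comparison of real numbers, and each operation on integers of $O(\log|V|)$ bits, in unit time, such that on every instance as above, with the edges listed in any order, the algorithm halts after at most $C\,|E|\log|V|\,(|E|+|V|\log|V|)$ steps and outputs an optimal solution of Problem 2, or reports that Problem 2 has no feasible solution if that is the case. -/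

import Mathlib

noncomputable section

namespace Rendezvous

/-! ## The Lagrangian relaxation of the recharging rendezvous problem -/

/-- A weighted bipartite graph `G = (V_a ∪ V_g, E)`. Here `V_a = Fin nA`, `V_g = Fin nG`, and `V_a` is
partitioned into the `numUAV` nonempty classes `{i | owner i = r}`, one for each UAV `r`.
An edge `e` has a cost `c e` and a weight `a e`. -/
structure Graph where
  numUAV : ℕ
  nA : ℕ
  nG : ℕ
  owner : Fin nA → Fin numUAV
  owner_surjective : Function.Surjective owner
  E : Finset (Fin nA × Fin nG)
  c : E → ℝ
  a : E → ℝ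

namespace Graph

variable (G : Graph)

/-- The number of vertices, `|V| = |V_a ∪ V_g|`. -/
def numV : ℕ := G.nA + G.nG

/-- The number of edges, `|E|`. -/
def numE : ℕ := G.E.card

/-- The constraints: each UAV has exactly one selected edge, each vertex of `V_g` at most one, and the
variables are `0` or `1`. -/
structure Feasible (x : G.E → ℝ) : Prop where
  uav : ∀ r : Fin G.numUAV, ∑ e : G.E with G.owner e.1.1 = r, x e = 1
  ugv : ∀ j : Fin G.nG, ∑ e : G.E with e.1.2 = j, x e ≤ 1
  integral : ∀ e, x e = 0 ∨ x e = 1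

/-- The objective `∑ c x + lam (∑ a x - B)`. -/
def objective (lam B : ℝ) (x : G.E → ℝ) : ℝ :=
  ∑ e, G.c e * x e + lam * (∑ e, G.a e * x e - B)

/-- `x` is an optimal solution of the Lagrangian relaxation with multiplier `lam`. -/
def IsOptimal (lam B : ℝ) (x : G.E → ℝ) : Prop :=
  G.Feasible x ∧ ∀ y, G.Feasible y → G.objective lam B x ≤ G.objective lam B y

end Graph

/-! ## Network flows -/

/-- A directed network (parallel arcs allowed) with arc capacities and arc costs. -/
structure FlowNetwork (Node Arc : Type) where
  source : Node
  sink : Node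
  tail : Arc → Node
  head : Arc → Node
  cap : Arc → ℕ
  cost : Arc → ℝ

/-- `f` is an integral flow that sends `val` units from the source to the sink. -/
structure FlowNetwork.IsFlow {Node Arc : Type} [DecidableEq Node] [Fintype Arc]
    (N : FlowNetwork Node Arc) (val : ℕ) (f : Arc → ℕ) : Prop where
  capacity : ∀ e, f e ≤ N.cap e
  conservation : ∀ v, v ≠ N.source → v ≠ N.sink →
    ∑ e with N.tail e = v, f e = ∑ e with N.head e = v, f e
  value : ∑ e with N.tail e = N.source, f e = ∑ e with N.head e = N.source, f e + val

/-- The cost of a flow. -/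
def FlowNetwork.flowCost {Node Arc : Type} [Fintype Arc] (N : FlowNetwork Node Arc)
    (f : Arc → ℕ) : ℝ :=
  ∑ e, N.cost e * (f e : ℝ)

/-- Nodes of the network of `G`: a source, a sink, one node per UAV, and the vertices of `G`. -/
inductive FlowNode (G : Graph) : Type
  | source
  | sink
  | uav (r : Fin G.numUAV)
  | left (i : Fin G.nA)
  | right (j : Fin G.nG)
  deriving DecidableEq

namespace Graph

variable (G : Graph)

/-- Arcs of the network of `G`: `source → uav r`; `uav r → left i` for `i` in the class of `r`;
`left i → right j` for an edge `(i, j)`; `right j → sink`. -/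
abbrev FlowArc : Type := Fin G.numUAV ⊕ Fin G.nA ⊕ G.E ⊕ Fin G.nG

/-- The arc of the network that stems from an edge of `G`. -/
def edgeArc (e : G.E) : G.FlowArc := .inr (.inr (.inl e))

/-- The network of `G`: all capacities are one, the arc of the edge `e` costs `c e + lam * a e` and the
other arcs cost zero. -/
def network (lam : ℝ) : FlowNetwork (FlowNode G) G.FlowArc where
  source := .source
  sink := .sink
  tail
    | .inl _ => .source
    | .inr (.inl i) => .uav (G.owner i)
    | .inr (.inr (.inl e)) => .left e.1.1
    | .inr (.inr (.inr j)) => .right j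
  head
    | .inl r => .uav r
    | .inr (.inl i) => .left i
    | .inr (.inr (.inl e)) => .right e.1.2
    | .inr (.inr (.inr _)) => .sink
  cap _ := 1
  cost
    | .inr (.inr (.inl e)) => G.c e + lam * G.a e
    | _ => 0

/-- The values of a flow on the arcs that stem from edges of `G`. -/
def restrict (f : G.FlowArc → ℕ) : G.E → ℝ := fun e => (f (G.edgeArc e) : ℝ)

end Graph

/-! ## A random access machine with real arithmetic

Programs are finite imperative programs over finitely many integer arrays and finitely many real
arrays. A scalar variable is a cell with constant index. Every operation, constant, memory access and
test takes one unit of time. -/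

/-- A memory: `nat k i` is cell `i` of the `k`-th integer array and `real k i` is cell `i` of the
`k`-th real array. -/
structure Memory where
  nat : ℕ → ℕ → ℕ
  real : ℕ → ℕ → ℝ

/-- Store an integer. -/
def Memory.setNat (s : Memory) (k i v : ℕ) : Memory :=
  { s with nat := Function.update s.nat k (Function.update (s.nat k) i v) }

/-- Store a real number. -/
def Memory.setReal (s : Memory) (k i : ℕ) (v : ℝ) : Memory :=
  { s with real := Function.update s.real k (Function.update (s.real k) i v) }

/-- Integer expressions. -/
inductive NExpr : Type
  | const (n : ℕ)
  | get (k : ℕ) (i : NExpr)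
  | add (p q : NExpr)
  | sub (p q : NExpr)
  | mul (p q : NExpr)
  | div (p q : NExpr)

/-- The value of an integer expression (subtraction is truncated at zero, division rounds down and
division by zero gives zero). -/
def NExpr.eval (s : Memory) : NExpr → ℕ
  | const n => n
  | get k i => s.nat k (i.eval s)
  | add p q => p.eval s + q.eval s
  | sub p q => p.eval s - q.eval s
  | mul p q => p.eval s * q.eval s
  | div p q => p.eval s / q.eval s

/-- The number of operations in an integer expression. -/
def NExpr.time : NExpr → ℕ
  | const _ => 1
  | get _ i => i.time + 1
  | add p q => p.time + q.time + 1
  | sub p q => p.time + q.time + 1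
  | mul p q => p.time + q.time + 1
  | div p q => p.time + q.time + 1

/-- Real expressions. The only real constants are `0` and `1`. -/
inductive RExpr : Type
  | zero
  | one
  | get (k : ℕ) (i : NExpr)
  | add (p q : RExpr)
  | sub (p q : RExpr)
  | mul (p q : RExpr)

/-- The value of a real expression. -/
def RExpr.eval (s : Memory) : RExpr → ℝ
  | zero => 0
  | one => 1
  | get k i => s.real k (i.eval s)
  | add p q => p.eval s + q.eval s
  | sub p q => p.eval s - q.eval s
  | mul p q => p.eval s * q.eval s

/-- The number of operations in a real expression. -/
def RExpr.time : RExpr → ℕ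
  | zero => 1
  | one => 1
  | get _ i => i.time + 1
  | add p q => p.time + q.time + 1
  | sub p q => p.time + q.time + 1
  | mul p q => p.time + q.time + 1

/-- Tests. -/
inductive Test : Type
  | natLe (p q : NExpr)
  | realLe (p q : RExpr)
  | neg (b : Test)
  | conj (b b' : Test)

/-- Whether a test succeeds. -/
def Test.Holds (s : Memory) : Test → Prop
  | natLe p q => p.eval s ≤ q.eval s
  | realLe p q => p.eval s ≤ q.eval s
  | neg b => ¬ b.Holds s
  | conj b b' => b.Holds s ∧ b'.Holds s

/-- The number of operations in a test. -/
def Test.time : Test → ℕ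
  | natLe p q => p.time + q.time + 1
  | realLe p q => p.time + q.time + 1
  | neg b => b.time + 1
  | conj b b' => b.time + b'.time + 1

/-- Programs. -/
inductive Program : Type
  | skip
  | setNat (k : ℕ) (i e : NExpr)
  | setReal (k : ℕ) (i : NExpr) (e : RExpr)
  | seq (P Q : Program)
  | ite (b : Test) (P Q : Program)
  | while (b : Test) (P : Program)

/-- `Exec W P s t s'`: the program `P`, started in the memory `s`, halts after `t` units of time in the
memory `s'`, and every integer it stores, and every address it stores to, is at most `W` on the way.
(A program that exceeds `W` has no execution. Expressions in a program have a fixed size, so that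
intermediate values in them stay polynomially bounded in `W`.) -/
inductive Exec (W : ℕ) : Program → Memory → ℕ → Memory → Prop
  | skip (s : Memory) : Exec W .skip s 1 s
  | setNat (k : ℕ) (i e : NExpr) (s : Memory) (hi : i.eval s ≤ W) (he : e.eval s ≤ W) :
      Exec W (.setNat k i e) s (i.time + e.time + 1) (s.setNat k (i.eval s) (e.eval s))
  | setReal (k : ℕ) (i : NExpr) (e : RExpr) (s : Memory) (hi : i.eval s ≤ W) :
      Exec W (.setReal k i e) s (i.time + e.time + 1) (s.setReal k (i.eval s) (e.eval s))
  | seq {P Q : Program} {s s' s'' : Memory} {t t' : ℕ} :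
      Exec W P s t s' → Exec W Q s' t' s'' → Exec W (.seq P Q) s (t + t') s''
  | ite_true {b : Test} {P Q : Program} {s s' : Memory} {t : ℕ} :
      b.Holds s → Exec W P s t s' → Exec W (.ite b P Q) s (b.time + t + 1) s'
  | ite_false {b : Test} {P Q : Program} {s s' : Memory} {t : ℕ} :
      ¬ b.Holds s → Exec W Q s t s' → Exec W (.ite b P Q) s (b.time + t + 1) s'
  | while_true {b : Test} {P : Program} {s s' s'' : Memory} {t t' : ℕ} :
      b.Holds s → Exec W P s t s' → Exec W (.while b P) s' t' s'' →
      Exec W (.while b P) s (b.time + t + t' + 1) s''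
  | while_false {b : Test} {P : Program} {s : Memory} :
      ¬ b.Holds s → Exec W (.while b P) s (b.time + 1) s

/-! ## Input and output -/

namespace Graph

variable (G : Graph)

/-- The list `v 0, …, v (n-1)` as the content of an array, followed by zeros. -/
def toArray {α : Type} [Zero α] {n : ℕ} (v : Fin n → α) : ℕ → α :=
  fun k => if h : k < n then v ⟨k, h⟩ else 0

/-- The initial memory, for the edges listed in the order `σ`. Integer arrays: `0` holds the numbers of
UAVs, of vertices in `V_a`, of vertices in `V_g` and of edges; `1` the owners of the vertices in `V_a`;
`2` and `3` the end points of the edges in `V_a` and in `V_g`. Real arrays: `0` holds `lam` and `B`; `1`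
the edge costs; `2` the edge weights. All other cells hold zero. -/
def input (σ : Fin G.numE ≃ G.E) (lam B : ℝ) : Memory where
  nat
    | 0 => toArray ![G.numUAV, G.nA, G.nG, G.numE]
    | 1 => toArray fun i => (G.owner i : ℕ)
    | 2 => toArray fun k => ((σ k).1.1 : ℕ)
    | 3 => toArray fun k => ((σ k).1.2 : ℕ)
    | _ => fun _ => 0
  real
    | 0 => toArray ![lam, B]
    | 1 => toArray fun k => G.c (σ k)
    | 2 => toArray fun k => G.a (σ k)
    | _ => fun _ => 0

/-- The vector that is read off integer array `4` of a memory. -/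
def output (σ : Fin G.numE ≃ G.E) (s : Memory) : G.E → ℝ :=
  fun e => (s.nat 4 (σ.symm e : ℕ) : ℝ)

/-- The memory `s` holds a correct answer: either cell `0` of integer array `5` is `1` and integer
array `4` holds an optimal solution, or that cell is `0` and there is no feasible solution. -/
def Answer (σ : Fin G.numE ≃ G.E) (lam B : ℝ) (s : Memory) : Prop :=
  (s.nat 5 0 = 1 ∧ G.IsOptimal lam B (G.output σ s)) ∨
    (s.nat 5 0 = 0 ∧ ¬ ∃ y, G.Feasible y)

end Graph

end Rendezvous

end

namespace Rendezvous

/-! ## Reasoning about programs -/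

/-- `P`, started in `s`, halts after some time `t` in some memory `s'` with `Q t s'`. -/
def WP (W : ℕ) (P : Program) (s : Memory) (Q : ℕ → Memory → Prop) : Prop :=
  ∃ t s', Exec W P s t s' ∧ Q t s'

theorem WP.mono {W : ℕ} {P : Program} {s : Memory} {Q Q' : ℕ → Memory → Prop}
    (h : WP W P s Q) (hQ : ∀ t s', Q t s' → Q' t s') : WP W P s Q' := by
  obtain ⟨t, s', he, hq⟩ := h
  exact ⟨t, s', he, hQ _ _ hq⟩

theorem wp_skip {W : ℕ} {s : Memory} {Q : ℕ → Memory → Prop} :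
    WP W .skip s Q ↔ Q 1 s := by
  constructor
  · rintro ⟨t, s', he, hq⟩
    cases he
    exact hq
  · exact fun h => ⟨_, _, .skip s, h⟩

theorem wp_setNat {W k : ℕ} {i e : NExpr} {s : Memory} {Q : ℕ → Memory → Prop} :
    WP W (.setNat k i e) s Q ↔ i.eval s ≤ W ∧ e.eval s ≤ W ∧
      Q (i.time + e.time + 1) (s.setNat k (i.eval s) (e.eval s)) := by
  constructor
  · rintro ⟨t, s', he, hq⟩
    cases he
    exact ⟨‹_›, ‹_›, hq⟩
  · exact fun ⟨h, h', hq⟩ => ⟨_, _, .setNat k i e s h h', hq⟩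

theorem wp_setReal {W k : ℕ} {i : NExpr} {e : RExpr} {s : Memory} {Q : ℕ → Memory → Prop} :
    WP W (.setReal k i e) s Q ↔ i.eval s ≤ W ∧
      Q (i.time + e.time + 1) (s.setReal k (i.eval s) (e.eval s)) := by
  constructor
  · rintro ⟨t, s', he, hq⟩
    cases he
    exact ⟨‹_›, hq⟩
  · exact fun ⟨h, hq⟩ => ⟨_, _, .setReal k i e s h, hq⟩

theorem wp_seq {W : ℕ} {P P' : Program} {s : Memory} {Q : ℕ → Memory → Prop} :
    WP W (.seq P P') s Q ↔
      WP W P s fun t s' => WP W P' s' fun t' s'' => Q (t + t') s'' := by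
  constructor
  · rintro ⟨t, s', he, hq⟩
    cases he with
    | seq h h' => exact ⟨_, _, h, _, _, h', hq⟩
  · rintro ⟨t, s', he, t', s'', he', hq⟩
    exact ⟨_, _, .seq he he', hq⟩

theorem wp_ite {W : ℕ} {b : Test} {P P' : Program} {s : Memory} {Q : ℕ → Memory → Prop} :
    WP W (.ite b P P') s Q ↔
      (b.Holds s → WP W P s fun t s' => Q (b.time + t + 1) s') ∧
      (¬ b.Holds s → WP W P' s fun t s' => Q (b.time + t + 1) s') := by
  constructor
  · rintro ⟨t, s', he, hq⟩
    cases he with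
    | ite_true h h' => exact ⟨fun _ => ⟨_, _, h', hq⟩, fun h2 => absurd h h2⟩
    | ite_false h h' => exact ⟨fun h2 => absurd h2 h, fun _ => ⟨_, _, h', hq⟩⟩
  · rintro ⟨h1, h2⟩
    by_cases h : b.Holds s
    · obtain ⟨t, s', he, hq⟩ := h1 h
      exact ⟨_, _, .ite_true h he, hq⟩
    · obtain ⟨t, s', he, hq⟩ := h2 h
      exact ⟨_, _, .ite_false h he, hq⟩

/-- The rule for loops: `I n s` is an invariant in which `n` bounds the time that is still needed. -/
theorem WP.while {W : ℕ} {b : Test} {P : Program} {Q : ℕ → Memory → Prop}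
    (I : ℕ → Memory → Prop) {n : ℕ} {s : Memory} (h0 : I n s)
    (hstep : ∀ n s, I n s → b.Holds s →
      WP W P s fun t s' => ∃ n', I n' s' ∧ t + b.time + 1 + n' ≤ n)
    (hend : ∀ n' s' t, I n' s' → ¬ b.Holds s' → t + n' ≤ n + b.time + 1 → Q t s') :
    WP W (.while b P) s Q := by
  induction n using Nat.strong_induction_on generalizing s Q with
  | _ n ih =>
    by_cases hb : b.Holds s
    · obtain ⟨t, s', he, n', hI, hn⟩ := hstep n s h0 hb
      obtain ⟨t', s'', he', hq⟩ := ih n' (by omega) (s := s')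
        (Q := fun t' s'' => Q (b.time + t + t' + 1) s'') hI
        (fun n'' s'' t' h1 h2 h3 => hend n'' s'' _ h1 h2 (by omega))
      exact ⟨_, _, .while_true hb he he', hq⟩
    · exact ⟨_, _, .while_false hb, hend n s _ h0 hb (by omega)⟩

theorem Memory.setNat_nat (s : Memory) (k i v k' : ℕ) :
    (s.setNat k i v).nat k' = if k' = k then Function.update (s.nat k) i v else s.nat k' := by
  simp [Memory.setNat, Function.update_apply]

theorem Memory.setNat_real (s : Memory) (k i v : ℕ) : (s.setNat k i v).real = s.real := rfl

theorem Memory.setReal_real (s : Memory) (k i : ℕ) (v : ℝ) (k' : ℕ) :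
    (s.setReal k i v).real k' =
      if k' = k then Function.update (s.real k) i v else s.real k' := by
  simp [Memory.setReal, Function.update_apply]

theorem Memory.setReal_nat (s : Memory) (k i : ℕ) (v : ℝ) :
    (s.setReal k i v).nat = s.nat := rfl

/-- `s'` agrees with `s` except on the integer arrays in `A` and the real arrays in `B`. -/
structure Memory.Agree (A B : List ℕ) (s s' : Memory) : Prop where
  nat : ∀ k, k ∉ A → s'.nat k = s.nat k
  real : ∀ k, k ∉ B → s'.real k = s.real k

theorem Memory.Agree.refl (A B : List ℕ) (s : Memory) : s.Agree A B s :=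
  ⟨fun _ _ => rfl, fun _ _ => rfl⟩

theorem Memory.Agree.trans {A B : List ℕ} {s s' s'' : Memory} (h : s.Agree A B s')
    (h' : s'.Agree A B s'') : s.Agree A B s'' :=
  ⟨fun k hk => (h'.nat k hk).trans (h.nat k hk),
    fun k hk => (h'.real k hk).trans (h.real k hk)⟩

theorem Memory.Agree.mono {A B A' B' : List ℕ} {s s' : Memory} (h : s.Agree A B s')
    (hA : A ⊆ A') (hB : B ⊆ B') : s.Agree A' B' s' :=
  ⟨fun k hk => h.nat k fun h' => hk (hA h'), fun k hk => h.real k fun h' => hk (hB h')⟩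

theorem Memory.Agree.setNat {A B : List ℕ} {s s' : Memory} (h : s.Agree A B s') {k : ℕ}
    (hk : k ∈ A) (i v : ℕ) : s.Agree A B (s'.setNat k i v) := by
  refine ⟨fun k' hk' => ?_, h.real⟩
  rw [Memory.setNat_nat, if_neg (by rintro rfl; exact hk' hk), h.nat k' hk']

theorem Memory.Agree.setReal {A B : List ℕ} {s s' : Memory} (h : s.Agree A B s') {k : ℕ}
    (hk : k ∈ B) (i : ℕ) (v : ℝ) : s.Agree A B (s'.setReal k i v) := by
  refine ⟨h.nat, fun k' hk' => ?_⟩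
  rw [Memory.setReal_real, if_neg (by rintro rfl; exact hk' hk), h.real k' hk']

/-- The scalar variable that is kept in cell `0` of integer array `k`. -/
abbrev NExpr.var (k : ℕ) : NExpr := .get k (.const 0)

/-! ## Tournament trees

A tournament tree on `m` items is an array `tr`: the children of node `i` are `2 * i` and `2 * i + 1`, the
leaf of item `k` is `m + k` and holds `k + 1` if the item is present and `0` otherwise, and an inner node
holds a present item of least key below it. -/

/-- The condition at an inner node. -/
structure NodeOK (tr : ℕ → ℕ) (key : ℕ → ℝ) (i : ℕ) : Prop where
  child : tr i = tr (2 * i) ∨ tr i = tr (2 * i + 1)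
  left : tr (2 * i) ≠ 0 → tr i ≠ 0 ∧ key (tr i - 1) ≤ key (tr (2 * i) - 1)
  right : tr (2 * i + 1) ≠ 0 → tr i ≠ 0 ∧ key (tr i - 1) ≤ key (tr (2 * i + 1) - 1)

/-- A tournament tree in which the condition may fail at the node `bad`. -/
structure Tournament (m : ℕ) (tr : ℕ → ℕ) (key : ℕ → ℝ) (bad : ℕ) : Prop where
  node : ∀ i, 1 ≤ i → i < m → i ≠ bad → NodeOK tr key i
  leaf : ∀ k, k < m → tr (m + k) = 0 ∨ tr (m + k) = k + 1
  le : ∀ i, i < 2 * m → tr i ≤ m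

theorem NodeOK.congr {tr tr' : ℕ → ℕ} {key key' : ℕ → ℝ} {i : ℕ} (h : NodeOK tr key i)
    (h0 : tr' i = tr i) (h1 : tr' (2 * i) = tr (2 * i)) (h2 : tr' (2 * i + 1) = tr (2 * i + 1))
    (k0 : tr i ≠ 0 → key' (tr i - 1) = key (tr i - 1))
    (k1 : tr (2 * i) ≠ 0 → key' (tr (2 * i) - 1) = key (tr (2 * i) - 1))
    (k2 : tr (2 * i + 1) ≠ 0 → key' (tr (2 * i + 1) - 1) = key (tr (2 * i + 1) - 1)) :
    NodeOK tr' key' i := by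
  refine ⟨by rw [h0, h1, h2]; exact h.child, fun h' => ?_, fun h' => ?_⟩
  · rw [h1] at h'
    have := h.left h'
    rw [h0, h1, k0 this.1, k1 h']
    exact this
  · rw [h2] at h'
    have := h.right h'
    rw [h0, h2, k0 this.1, k2 h']
    exact this

namespace Tournament

variable {m : ℕ} {tr : ℕ → ℕ} {key : ℕ → ℝ}

theorem of_zero (m : ℕ) {tr : ℕ → ℕ} (key : ℕ → ℝ) (h : ∀ i, i < 2 * m → tr i = 0) :
    Tournament m tr key 0 := by
  refine ⟨fun i h1 h2 _ => ⟨.inl ?_, fun h' => ?_, fun h' => ?_⟩, fun k hk => .inl ?_,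
    fun i hi => ?_⟩
  · rw [h i (by omega), h (2 * i) (by omega)]
  · exact absurd (h (2 * i) (by omega)) h'
  · exact absurd (h (2 * i + 1) (by omega)) h'
  · exact h _ (by omega)
  · rw [h i hi]; omega

/-- A nonzero entry is a copy of a child's entry; following the copies downwards ends at the leaf of
the item itself. -/
theorem leaf_of_node (h : Tournament m tr key 0) {i : ℕ} (h1 : 1 ≤ i) (h2 : i < 2 * m)
    (hi : tr i ≠ 0) : tr i - 1 < m ∧ tr (m + (tr i - 1)) = tr i := by
  by_cases him : i < m
  · rcases (h.node i h1 him (by omega)).child with hc | hc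
    · have := leaf_of_node h (i := 2 * i) (by omega) (by omega) (hc ▸ hi)
      rwa [← hc] at this
    · have := leaf_of_node h (i := 2 * i + 1) (by omega) (by omega) (hc ▸ hi)
      rwa [← hc] at this
  · obtain ⟨k, rfl⟩ : ∃ k, i = m + k := ⟨i - m, by omega⟩
    have hk := (h.leaf k (by omega)).resolve_left hi
    rw [hk]
    exact ⟨by omega, by simpa using hk⟩
termination_by 2 * m - i

/-- Each parent dominates both children, so keys do not increase on the way from `i` up to the root.
-/
theorem root_le (h : Tournament m tr key 0) {i : ℕ} (h1 : 1 ≤ i) (h2 : i < 2 * m)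
    (hi : tr i ≠ 0) : tr 1 ≠ 0 ∧ key (tr 1 - 1) ≤ key (tr i - 1) := by
  induction i using Nat.strong_induction_on with
  | _ i ih =>
    rcases Nat.lt_or_ge 1 i with h3 | h3
    · have hn := h.node (i / 2) (by omega) (by omega) (by omega)
      have hp : tr (i / 2) ≠ 0 ∧ key (tr (i / 2) - 1) ≤ key (tr i - 1) := by
        rcases Nat.even_or_odd' i with ⟨c, rfl | rfl⟩
        · have : 2 * c / 2 = c := by omega
          rw [this] at hn ⊢
          exact hn.left hi
        · have : (2 * c + 1) / 2 = c := by omega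
          rw [this] at hn ⊢
          exact hn.right hi
      have := ih (i / 2) (by omega) (by omega) (by omega) hp.1
      exact ⟨this.1, this.2.trans hp.2⟩
    · obtain rfl : i = 1 := by omega
      exact ⟨hi, le_rfl⟩

theorem root_spec (h : Tournament m tr key 0) (hm : 1 ≤ m) (h1 : tr 1 ≠ 0) :
    tr 1 - 1 < m ∧ tr (m + (tr 1 - 1)) ≠ 0 ∧
      ∀ k, k < m → tr (m + k) ≠ 0 → key (tr 1 - 1) ≤ key k := by
  obtain ⟨h2, h3⟩ := h.leaf_of_node le_rfl (by omega) h1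
  refine ⟨h2, by rw [h3]; exact h1, fun k hk hk' => ?_⟩
  have := (h.root_le (i := m + k) (by omega) (by omega) hk').2
  rwa [(h.leaf k hk).resolve_left hk', Nat.add_sub_cancel] at this

theorem root_eq_zero (h : Tournament m tr key 0) (h1 : tr 1 = 0) {k : ℕ} (hk : k < m) :
    tr (m + k) = 0 := by
  by_contra h'
  exact (h.root_le (i := m + k) (by omega) (by omega) h').1 h1

/-- Only its parent looks at a leaf, so the defect is confined there. For `m = 1` the leaf is the
root, and the defective node `0` is not an inner node. -/
theorem erase_leaf (h : Tournament m tr key 0) (k : ℕ) :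
    Tournament m (Function.update tr (m + k) 0) key ((m + k) / 2) := by
  refine ⟨fun i h1 h2 h3 => ?_, fun k' hk' => ?_, fun i hi => ?_⟩
  · refine (h.node i h1 h2 (by omega)).congr ?_ ?_ ?_ (fun _ => rfl) (fun _ => rfl) fun _ => rfl
    all_goals exact Function.update_of_ne (by omega) _ _
  · rw [Function.update_apply]
    split_ifs
    · exact .inl rfl
    · exact h.leaf k' hk'
  · rw [Function.update_apply]
    split_ifs
    · omega
    · exact h.le i hi

theorem insert_leaf (h : Tournament m tr key 0) {k : ℕ} (hk : k < m) (h0 : tr (m + k) = 0)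
    (v : ℝ) : Tournament m (Function.update tr (m + k) (k + 1)) (Function.update key k v)
      ((m + k) / 2) := by
  -- Item `k` is absent and every nonzero entry names a present item, so no comparison involves the
  -- changed key.
  have aux : ∀ i, 1 ≤ i → i < 2 * m → tr i ≠ 0 →
      Function.update key k v (tr i - 1) = key (tr i - 1) := by
    intro i h1 h2 h3
    refine Function.update_of_ne (fun h4 => ?_) _ _
    have := (h.leaf_of_node h1 h2 h3).2
    rw [h4, h0] at this
    exact h3 this.symm
  refine ⟨fun i h1 h2 h3 => ?_, fun k' hk' => ?_, fun i hi => ?_⟩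
  · refine (h.node i h1 h2 (by omega)).congr ?_ ?_ ?_ (aux _ h1 (by omega))
      (aux _ (by omega) (by omega)) (aux _ (by omega) (by omega))
    all_goals exact Function.update_of_ne (by omega) _ _
  · rw [Function.update_apply]
    split_ifs with h1
    · right; omega
    · exact h.leaf k' hk'
  · rw [Function.update_apply]
    split_ifs
    · omega
    · exact h.le i hi

/-- Apart from `i` itself, only its parent looks at the entry of `i`, so a correct value moves the
defect to `i / 2`. Above the root this is `0`, which means that the tree is intact. -/
theorem repair {i : ℕ} (h : Tournament m tr key i) (hi1 : 1 ≤ i) (him : i < m) {v : ℕ}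
    (h0 : v = tr (2 * i) ∨ v = tr (2 * i + 1))
    (h1 : tr (2 * i) ≠ 0 → v ≠ 0 ∧ key (v - 1) ≤ key (tr (2 * i) - 1))
    (h2 : tr (2 * i + 1) ≠ 0 → v ≠ 0 ∧ key (v - 1) ≤ key (tr (2 * i + 1) - 1)) :
    Tournament m (Function.update tr i v) key (i / 2) := by
  refine ⟨fun i' h3 h4 h5 => ?_, fun k hk => ?_, fun i' h3 => ?_⟩
  · by_cases hii : i' = i
    · subst hii
      have e1 : Function.update tr i' v (2 * i') = tr (2 * i') :=
        Function.update_of_ne (by omega) _ _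
      have e2 : Function.update tr i' v (2 * i' + 1) = tr (2 * i' + 1) :=
        Function.update_of_ne (by omega) _ _
      exact ⟨by simpa [e1, e2] using h0, by simpa [e1] using h1, by simpa [e2] using h2⟩
    · refine (h.node i' h3 h4 hii).congr ?_ ?_ ?_ (fun _ => rfl) (fun _ => rfl) fun _ => rfl
      all_goals exact Function.update_of_ne (by omega) _ _
  · rw [Function.update_of_ne (by omega)]
    exact h.leaf k hk
  · rw [Function.update_apply]
    split_ifs
    · rcases h0 with h0 | h0 <;> rw [h0] <;> exact h.le _ (by omega)
    · exact h.le i' h3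

end Tournament

/-! ## Adjacency lists -/

/-- One more than the last `k < q` with `row k = u`, or `0` if there is none. -/
def lastEdge (row : ℕ → ℕ) (u : ℕ) : ℕ → ℕ
  | 0 => 0
  | q + 1 => if row q = u then q + 1 else lastEdge row u q

/-- The number of `k < q` with `row k = u`. -/
def countEdges (row : ℕ → ℕ) (u : ℕ) : ℕ → ℕ
  | 0 => 0
  | q + 1 => countEdges row u q + if row q = u then 1 else 0

theorem lastEdge_le (row : ℕ → ℕ) (u q : ℕ) : lastEdge row u q ≤ q := by
  induction q with
  | zero => simp [lastEdge]
  | succ q ih => simp only [lastEdge]; split_ifs <;> omega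

theorem lastEdge_spec {row : ℕ → ℕ} {u q : ℕ} (h : lastEdge row u q ≠ 0) :
    row (lastEdge row u q - 1) = u ∧
      countEdges row u q = countEdges row u (lastEdge row u q - 1) + 1 := by
  induction q with
  | zero => simp [lastEdge] at h
  | succ q ih =>
    by_cases h' : row q = u
    · simp [lastEdge, countEdges, h']
    · simpa [lastEdge, countEdges, h'] using ih (by simpa [lastEdge, h'] using h)

/-- This makes the adjacency lists complete: no edge of `u` is skipped between consecutive entries.
-/
theorem row_ne_of_lastEdge_le {row : ℕ → ℕ} {u q k : ℕ} (hk : k < q)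
    (h : lastEdge row u q ≤ k) : row k ≠ u := by
  induction q with
  | zero => omega
  | succ q ih =>
    by_cases h' : row q = u
    · simp only [lastEdge, h', if_true] at h
      omega
    · simp only [lastEdge, h', if_false] at h
      rcases Nat.lt_succ_iff_lt_or_eq.1 hk with h2 | rfl
      · exact ih h2 h
      · exact h'

/-! ## The assignment problem -/

/-- A bipartite multigraph with `R` rows, `nG` columns and `m` edges; edge `k` joins `row k` to `col k`. -/
structure AssignmentProblem where
  R : ℕ
  nG : ℕ
  m : ℕ
  row : ℕ → ℕ
  col : ℕ → ℕ
  cost : ℕ → ℝ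
  row_lt : ∀ k, k < m → row k < R
  col_lt : ∀ k, k < m → col k < nG

namespace AssignmentProblem

variable (I : AssignmentProblem)

/-- `f` selects an edge at every row, with distinct columns. -/
structure Assigns (f : ℕ → ℕ) : Prop where
  lt : ∀ u, u < I.R → f u < I.m
  row : ∀ u, u < I.R → I.row (f u) = u
  inj : ∀ u u', u < I.R → u' < I.R → I.col (f u) = I.col (f u') → u = u'

/-- `mL` and `mR` describe a matching of the rows below `r`: they hold one more than the selected edge,
or `0`. -/
structure Matching (r : ℕ) (mL mR : ℕ → ℕ) : Prop where
  left : ∀ u k, mL u = k + 1 → k < I.m ∧ I.row k = u ∧ mR (I.col k) = k + 1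
  zero : ∀ u, mL u = 0 ↔ r ≤ u
  right : ∀ j k, mR j = k + 1 → k < I.m ∧ I.col k = j ∧ mL (I.row k) = k + 1

/-- Dual variables that are feasible for the rows below `r` and complementary to the matching. -/
structure Dual (r : ℕ) (mL mR : ℕ → ℕ) (yu yw : ℕ → ℝ) : Prop where
  feas : ∀ k, k < I.m → I.row k < r → yu (I.row k) + yw (I.col k) ≤ I.cost k
  tight : ∀ k, k < I.m → mL (I.row k) = k + 1 → yu (I.row k) + yw (I.col k) = I.cost k
  nonpos : ∀ j, j < I.nG → yw j ≤ 0
  free : ∀ j, j < I.nG → mR j = 0 → yw j = 0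

variable {I}

/-- Rows from `r` on have no constraint and no matched edge yet, so their dual variables are
arbitrary. -/
theorem Dual.congr {r : ℕ} {mL mR : ℕ → ℕ} {yu yw yu' yw' : ℕ → ℝ}
    (h : I.Dual r mL mR yu yw) (hmL : ∀ u, r ≤ u → mL u = 0)
    (hu : ∀ u, u < r → yu' u = yu u)
    (hw : ∀ j, j < I.nG → yw' j = yw j) : I.Dual r mL mR yu' yw' := by
  refine ⟨fun k hk hr => ?_, fun k hk hr => ?_, fun j hj => ?_, fun j hj h0 => ?_⟩
  · rw [hu _ hr, hw _ (I.col_lt k hk)]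
    exact h.feas k hk hr
  · have : I.row k < r := by
      by_contra h'
      have := hmL _ (not_lt.1 h')
      omega
    rw [hu _ this, hw _ (I.col_lt k hk)]
    exact h.tight k hk hr
  · rw [hw _ hj]; exact h.nonpos j hj
  · rw [hw _ hj]; exact h.free j hj h0

theorem Matching.assigns {mL mR : ℕ → ℕ} (h : I.Matching I.R mL mR) :
    I.Assigns fun u => mL u - 1 := by
  have key : ∀ u, u < I.R → mL u = (mL u - 1) + 1 := by
    intro u hu
    have := (h.zero u).not.2 (by omega)
    omega
  refine ⟨fun u hu => (h.left u _ (key u hu)).1, fun u hu => (h.left u _ (key u hu)).2.1,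
    fun u u' hu hu' he => ?_⟩
  have h1 := h.left u _ (key u hu)
  have h2 := h.left u' _ (key u' hu')
  have h3 := h1.2.2
  rw [he, h2.2.2] at h3
  rw [← h1.2.1, ← h2.2.1]
  congr 1
  omega

/-- Weak duality. -/
theorem Dual.le_cost {r : ℕ} {mL mR : ℕ → ℕ} {yu yw : ℕ → ℝ} (h : I.Dual r mL mR yu yw)
    (hr : r = I.R) {f : ℕ → ℕ} (hf : I.Assigns f) :
    ∑ u ∈ Finset.range I.R, yu u + ∑ j ∈ Finset.range I.nG, yw j ≤
      ∑ u ∈ Finset.range I.R, I.cost (f u) := by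
  -- Columns may stay unused; dropping their nonpositive dual variables does not decrease the sum.
  have h1 : ∑ j ∈ Finset.range I.nG, yw j ≤ ∑ u ∈ Finset.range I.R, yw (I.col (f u)) := by
    rw [← Finset.sum_image (s := Finset.range I.R) (g := fun u => I.col (f u)) (f := yw)]
    · rw [← neg_le_neg_iff, ← Finset.sum_neg_distrib, ← Finset.sum_neg_distrib]
      refine Finset.sum_le_sum_of_subset_of_nonneg ?_ fun j hj _ => ?_
      · intro j hj
        obtain ⟨u, hu, rfl⟩ := Finset.mem_image.1 hj
        exact Finset.mem_range.2 (I.col_lt _ (hf.lt u (Finset.mem_range.1 hu)))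
      · have := h.nonpos j (Finset.mem_range.1 hj)
        linarith
    · intro u hu u' hu' he
      exact hf.inj u u' (by simpa using hu) (by simpa using hu') he
  have h2 : ∑ u ∈ Finset.range I.R, (yu u + yw (I.col (f u))) ≤
      ∑ u ∈ Finset.range I.R, I.cost (f u) := by
    refine Finset.sum_le_sum fun u hu => ?_
    have hu := Finset.mem_range.1 hu
    have := h.feas (f u) (hf.lt u hu) (by rw [hf.row u hu, hr]; exact hu)
    rwa [hf.row u hu] at this
  rw [Finset.sum_add_distrib] at h2
  linarith

/-- Complementary slackness: matched edges are tight, and unmatched columns contribute zero. -/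
theorem Dual.cost_eq {mL mR : ℕ → ℕ} {yu yw : ℕ → ℝ} (h : I.Dual I.R mL mR yu yw)
    (hM : I.Matching I.R mL mR) :
    ∑ u ∈ Finset.range I.R, I.cost (mL u - 1) =
      ∑ u ∈ Finset.range I.R, yu u + ∑ j ∈ Finset.range I.nG, yw j := by
  have hf := hM.assigns
  have key : ∀ u, u < I.R → mL u = (mL u - 1) + 1 := by
    intro u hu
    have := (hM.zero u).not.2 (by omega)
    omega
  have h1 : ∑ j ∈ Finset.range I.nG, yw j =
      ∑ u ∈ Finset.range I.R, yw (I.col (mL u - 1)) := by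
    rw [← Finset.sum_image (s := Finset.range I.R) (g := fun u => I.col (mL u - 1)) (f := yw)]
    · symm
      refine Finset.sum_subset ?_ fun j hj hj' => ?_
      · intro j hj
        obtain ⟨u, hu, rfl⟩ := Finset.mem_image.1 hj
        exact Finset.mem_range.2 (I.col_lt _ (hf.lt u (Finset.mem_range.1 hu)))
      · refine h.free j (Finset.mem_range.1 hj) ?_
        by_contra h0
        obtain ⟨k, hk⟩ := Nat.exists_eq_succ_of_ne_zero h0
        obtain ⟨h2, h3, h4⟩ := hM.right j k hk
        exact hj' (Finset.mem_image.2 ⟨I.row k, Finset.mem_range.2 (I.row_lt k h2), by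
          simp [h4, h3]⟩)
    · intro u hu u' hu' he
      exact hf.inj u u' (by simpa using hu) (by simpa using hu') he
  rw [h1, ← Finset.sum_add_distrib]
  refine Finset.sum_congr rfl fun u hu => ?_
  have hu := Finset.mem_range.1 hu
  have h2 := hM.left u _ (key u hu)
  have := h.tight (mL u - 1) h2.1 (by rw [h2.2.1]; exact key u hu)
  rw [← this, h2.2.1]

/-! ### The search for an augmenting path -/

variable (I)

/-- The row `u` belongs to the search tree with root `r`: `par j` holds one more than the edge through
which the column `j` was reached, or `0`. -/
def InTree (r : ℕ) (mL par : ℕ → ℕ) (u : ℕ) : Prop :=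
  u = r ∨ (mL u ≠ 0 ∧ par (I.col (mL u - 1)) ≠ 0)

open Classical in
/-- The dual variable of a row. During a search, rows in the tree are stored with the offset `-d`. -/
noncomputable def effU (r : ℕ) (mL par : ℕ → ℕ) (yu : ℕ → ℝ) (d : ℝ) (u : ℕ) : ℝ :=
  if I.InTree r mL par u then yu u + d else yu u

/-- The dual variable of a column. During a search, reached columns are stored with the offset `d`. -/
noncomputable def effW (par : ℕ → ℕ) (yw : ℕ → ℝ) (d : ℝ) (j : ℕ) : ℝ :=
  if par j = 0 then yw j else yw j - d

/-- The number of reached columns. -/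
def reached (par : ℕ → ℕ) : ℕ := ((Finset.range I.nG).filter fun j => par j ≠ 0).card

/-- The state of a search with root `r` at distance `d`; `ord` is the order in which columns were
reached. -/
structure Search (r : ℕ) (mL mR par : ℕ → ℕ) (yu yw : ℕ → ℝ) (d : ℝ) (ord : ℕ → ℕ) : Prop where
  matching : I.Matching r mL mR
  dual : I.Dual (r + 1) mL mR (I.effU r mL par yu d) (effW par yw d)
  through : ∀ j k, par j = k + 1 → k < I.m ∧ I.col k = j ∧ I.InTree r mL par (I.row k) ∧
    I.effU r mL par yu d (I.row k) + effW par yw d j = I.cost k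
  ordered : ∀ j k, par j = k + 1 → mL (I.row k) ≠ 0 → ord (I.col (mL (I.row k) - 1)) < ord j
  ord_lt : ∀ j, par j ≠ 0 → ord j < I.reached par

/-- The queue of a search: the edges that leave rows of the tree and are not processed. -/
structure Queue (r : ℕ) (mL mR par tr : ℕ → ℕ) (yu yw key : ℕ → ℝ) : Prop where
  tournament : Tournament I.m tr key 0
  active : ∀ k, k < I.m → I.InTree r mL par (I.row k) → par (I.col k) = 0 → tr (I.m + k) ≠ 0
  inTree : ∀ k, k < I.m → tr (I.m + k) ≠ 0 → I.InTree r mL par (I.row k)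
  key : ∀ k, k < I.m → tr (I.m + k) ≠ 0 → par (I.col k) = 0 →
    key k = I.cost k - yu (I.row k) - yw (I.col k)
  matched : ∀ j, par j ≠ 0 → mR j ≠ 0

variable {I} {r : ℕ} {mL mR par tr ord : ℕ → ℕ} {yu yw key : ℕ → ℝ} {d : ℝ}

theorem Search.start (hM : I.Matching r mL mR) (hD : I.Dual r mL mR yu yw)
    (hp : ∀ j, par j = 0) : ∃ d, I.Search r mL mR par yu yw d fun _ => 0 := by
  -- A sufficiently low dual variable at the root satisfies all its edges. This `d` exists only in
  -- the proof: the program stores a distance when it removes the first edge from the queue.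
  obtain ⟨d, hd⟩ : ∃ d : ℝ, ∀ k, k < I.m → d ≤ I.cost k - yu (I.row k) - yw (I.col k) := by
    obtain ⟨d, hd⟩ := ((Finset.range I.m).image
      fun k => I.cost k - yu (I.row k) - yw (I.col k)).bddBelow
    exact ⟨d, fun k hk => hd (by simpa using ⟨k, hk, rfl⟩)⟩
  have hT : ∀ u, I.InTree r mL par u ↔ u = r := by
    intro u; simp [InTree, hp]
  have hU : ∀ u, I.effU r mL par yu d u = if u = r then yu u + d else yu u := by
    intro u
    simp only [effU, hT]
  have hW : ∀ j, effW par yw d j = yw j := by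
    intro j; simp [effW, hp]
  refine ⟨d, hM, ⟨fun k hk hr => ?_, fun k hk hr => ?_, fun j hj => ?_, fun j hj h0 => ?_⟩,
    fun j k h => ?_, fun j k h => ?_, fun j h => ?_⟩
  · rw [hU, hW]
    split_ifs with h
    · have := hd k hk; linarith
    · exact hD.feas k hk (by omega)
  · rw [hU, hW, if_neg]
    · exact hD.tight k hk hr
    · rintro h
      have := (hM.zero (I.row k)).2 h.ge
      omega
  · rw [hW]; exact hD.nonpos j hj
  · rw [hW]; exact hD.free j hj h0
  · rw [hp] at h; omega
  · rw [hp] at h; omega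
  · exact absurd (hp j) h

/-- Tree rows rise and reached columns fall by the same amount, so only edges from the tree to
unreached columns lose slack, and `hb` limits that loss. Reached columns are matched by `hmat`, so
free columns keep the dual variable zero. -/
theorem Search.advance (h : I.Search r mL mR par yu yw d ord) {d' : ℝ} (hd : d ≤ d')
    (hb : ∀ k, k < I.m → I.InTree r mL par (I.row k) → par (I.col k) = 0 →
      d' ≤ I.cost k - yu (I.row k) - yw (I.col k))
    (hmat : ∀ j, par j ≠ 0 → mR j ≠ 0) :
    I.Search r mL mR par yu yw d' ord := by
  have hU : ∀ u, I.InTree r mL par u → ∀ x, I.effU r mL par yu x u = yu u + x :=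
    fun u hu x => if_pos hu
  have hU' : ∀ u, ¬ I.InTree r mL par u → ∀ x, I.effU r mL par yu x u = yu u :=
    fun u hu x => if_neg hu
  have hW : ∀ j, par j = 0 → ∀ x, effW par yw x j = yw j := fun u hu x => if_pos hu
  have hW' : ∀ j, par j ≠ 0 → ∀ x, effW par yw x j = yw j - x := fun u hu x => if_neg hu
  refine ⟨h.matching, ⟨fun k hk hr => ?_, fun k hk hr => ?_, fun j hj => ?_, fun j hj h0 => ?_⟩,
    fun j k hj => ?_, h.ordered, h.ord_lt⟩
  · have h1 := h.dual.feas k hk hr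
    by_cases hT : I.InTree r mL par (I.row k) <;> by_cases hp : par (I.col k) = 0
    · have := hb k hk hT hp
      rw [hU _ hT, hW _ hp]; linarith
    · rw [hU _ hT, hW' _ hp] at h1 ⊢; linarith
    · rw [hU' _ hT, hW _ hp] at h1 ⊢; linarith
    · rw [hU' _ hT, hW' _ hp] at h1 ⊢; linarith
  · have h1 := h.dual.tight k hk hr
    have h2 : I.row k ≠ r := by
      intro h2
      have := (h.matching.zero (I.row k)).2 h2.ge
      omega
    -- A matched edge has both ends in the tree or neither, so it stays tight.
    have h3 : I.InTree r mL par (I.row k) ↔ par (I.col k) ≠ 0 := by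
      simp [InTree, h2, hr]
    by_cases hp : par (I.col k) = 0
    · have hT : ¬ I.InTree r mL par (I.row k) := by rw [h3]; exact not_not.2 hp
      rw [hU' _ hT, hW _ hp] at h1 ⊢; linarith
    · rw [hU _ (h3.2 hp), hW' _ hp] at h1 ⊢; linarith
  · have h1 := h.dual.nonpos j hj
    by_cases hp : par j = 0
    · rw [hW _ hp] at h1 ⊢; exact h1
    · rw [hW' _ hp] at h1 ⊢; linarith
  · have hp : par j = 0 := by
      by_contra hp
      exact hmat j hp h0
    have h1 := h.dual.free j hj h0
    rw [hW _ hp] at h1 ⊢; exact h1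
  · obtain ⟨h1, h2, h3, h4⟩ := h.through j k hj
    refine ⟨h1, h2, h3, ?_⟩
    rw [hU _ h3, hW' _ (by omega)] at h4 ⊢
    linarith

/-- Rows other than the root enter the tree only through their matched column, so a newly reached
column brings in its mate and nothing else. -/
theorem inTree_update (hM : I.Matching r mL mR) {j k' : ℕ} (u : ℕ) :
    I.InTree r mL (Function.update par j (k' + 1)) u ↔
      I.InTree r mL par u ∨ (mR j ≠ 0 ∧ u = I.row (mR j - 1)) := by
  constructor
  · rintro (h | ⟨h1, h2⟩)
    · exact .inl (.inl h)
    · by_cases hj : I.col (mL u - 1) = j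
      · right
        obtain ⟨h3, h4, h5⟩ := hM.left u (mL u - 1) (by omega)
        rw [hj] at h5
        refine ⟨by omega, ?_⟩
        rw [h5, Nat.add_sub_cancel, h4]
      · rw [Function.update_of_ne hj] at h2
        exact .inl (.inr ⟨h1, h2⟩)
  · rintro ((h | ⟨h1, h2⟩) | ⟨h1, rfl⟩)
    · exact .inl h
    · refine .inr ⟨h1, ?_⟩
      rw [Function.update_apply]
      split_ifs
      · omega
      · exact h2
    · obtain ⟨h3, h4, h5⟩ := hM.right j (mR j - 1) (by omega)
      refine .inr ⟨by omega, ?_⟩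
      rw [h5, Nat.add_sub_cancel, h4, Function.update_self]
      omega

theorem not_inTree_mate (hM : I.Matching r mL mR) {j : ℕ} (hj : par j = 0) (h0 : mR j ≠ 0) :
    ¬ I.InTree r mL par (I.row (mR j - 1)) := by
  obtain ⟨h3, h4, h5⟩ := hM.right j (mR j - 1) (by omega)
  rintro (h | ⟨h1, h2⟩)
  · have := (hM.zero _).2 h.ge
    omega
  · rw [h5, Nat.add_sub_cancel, h4] at h2
    exact h2 hj

/-- Reaching the column of the edge `k`. -/
theorem Search.reach (h : I.Search r mL mR par yu yw d ord) {k : ℕ} (hk : k < I.m)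
    (hT : I.InTree r mL par (I.row k)) (h0 : par (I.col k) = 0)
    (hd : I.cost k - yu (I.row k) - yw (I.col k) = d) {yu' : ℕ → ℝ}
    (hyu : ∀ u, yu' u =
      if mR (I.col k) ≠ 0 ∧ u = I.row (mR (I.col k) - 1) then yu u - d else yu u) :
    ∃ ord', I.Search r mL mR (Function.update par (I.col k) (k + 1)) yu'
      (Function.update yw (I.col k) (yw (I.col k) + d)) d ord' := by
  set j := I.col k with hj
  have hM := h.matching
  have hjn : j < I.nG := I.col_lt k hk
  -- The mate enters with `d` subtracted and the column with `d` added, which cancels the offsets: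
  -- no effective dual variable changes.
  have hU : I.effU r mL (Function.update par j (k + 1)) yu' d = I.effU r mL par yu d := by
    funext u
    have hTu := inTree_update (par := par) (j := j) (k' := k) hM u
    rw [effU, effU, hyu]
    by_cases h1 : mR j ≠ 0 ∧ u = I.row (mR j - 1)
    · have h2 : ¬ I.InTree r mL par u := by
        rw [h1.2]; exact not_inTree_mate hM h0 h1.1
      rw [if_pos (hTu.2 (.inr h1)), if_pos h1, if_neg h2]; ring
    · rw [if_neg h1]
      by_cases h2 : I.InTree r mL par u
      · rw [if_pos (hTu.2 (.inl h2)), if_pos h2]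
      · rw [if_neg fun h3 => (hTu.1 h3).elim h2 h1, if_neg h2]
  have hW : effW (Function.update par j (k + 1)) (Function.update yw j (yw j + d)) d =
      effW par yw d := by
    funext j'
    by_cases hjj : j' = j
    · subst hjj
      simp [effW, h0]
    · simp [effW, hjj]
  have hreach : I.reached (Function.update par j (k + 1)) = I.reached par + 1 := by
    rw [reached, reached, ← Finset.card_insert_of_notMem (a := j) (by simp [h0])]
    congr 1
    ext j'
    by_cases hjj : j' = j
    · subst hjj; simp [hjn]
    · simp [hjj]
  -- The number of columns reached so far exceeds all ranks given out, so it serves as the rank of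
  -- `j`.
  refine ⟨Function.update ord j (I.reached par), hM, by rw [hU, hW]; exact h.dual,
    fun j' k' hj' => ?_, fun j' k' hj' hm => ?_, fun j' hj' => ?_⟩
  · rw [hU, hW, inTree_update hM]
    by_cases hjj : j' = j
    · subst hjj
      rw [Function.update_self] at hj'
      obtain rfl : k = k' := by omega
      refine ⟨hk, hj.symm, .inl hT, ?_⟩
      have h1 : I.effU r mL par yu d (I.row k) = yu (I.row k) + d := if_pos hT
      have h2 : effW par yw d j = yw j := if_pos h0
      rw [h1, h2]; linarith
    · rw [Function.update_of_ne hjj] at hj'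
      obtain ⟨h1, h2, h3, h4⟩ := h.through j' k' hj'
      exact ⟨h1, h2, .inl h3, h4⟩
  · have aux : ∀ u, I.InTree r mL par u → mL u ≠ 0 → par (I.col (mL u - 1)) ≠ 0 ∧
        I.col (mL u - 1) ≠ j := by
      rintro u (h1 | ⟨h1, h2⟩) hm
      · exact absurd ((hM.zero u).2 h1.ge) hm
      · exact ⟨h2, fun h3 => h2 (h3 ▸ h0)⟩
    by_cases hjj : j' = j
    · subst hjj
      rw [Function.update_self] at hj'
      obtain rfl : k = k' := by omega
      obtain ⟨h1, h2⟩ := aux _ hT hm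
      rw [Function.update_of_ne h2, Function.update_self]
      exact h.ord_lt _ h1
    · rw [Function.update_of_ne hjj] at hj'
      obtain ⟨h1, h2⟩ := aux _ (h.through j' k' hj').2.2.1 hm
      rw [Function.update_of_ne h2, Function.update_of_ne hjj]
      exact h.ordered j' k' hj' hm
  · rw [hreach]
    by_cases hjj : j' = j
    · subst hjj
      rw [Function.update_self]; omega
    · rw [Function.update_of_ne hjj] at hj' ⊢
      have := h.ord_lt j' hj'
      omega

/-- The column of the first edge in the queue, if not reached, can be reached next. -/
theorem Search.advance_root (h : I.Search r mL mR par yu yw d ord)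
    (hQ : I.Queue r mL mR par tr yu yw key) (hm : 1 ≤ I.m) (h1 : tr 1 ≠ 0)
    (h0 : par (I.col (tr 1 - 1)) = 0) :
    I.Search r mL mR par yu yw (key (tr 1 - 1)) ord := by
  obtain ⟨h2, h3, h4⟩ := hQ.tournament.root_spec hm h1
  have hT := hQ.inTree _ h2 h3
  have hk := hQ.key _ h2 h3 h0
  refine h.advance ?_ (fun k hk hT h0 => ?_) hQ.matched
  · have hr : I.row (tr 1 - 1) < r + 1 := by
      rcases hT with hT | ⟨hT, _⟩
      · omega
      · have := (h.matching.zero _).not.1 hT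
        omega
    have := h.dual.feas _ h2 hr
    rw [effU, if_pos hT, effW, if_pos h0] at this
    linarith
  · rw [← hQ.key k hk (hQ.active k hk hT h0) h0]
    exact h4 k hk (hQ.active k hk hT h0)

/-- If the queue runs empty, then there is no assignment. -/
theorem Search.not_assigns (h : I.Search r mL mR par yu yw d ord) (hr : r < I.R)
    (hQ : I.Queue r mL mR par tr yu yw key) (h1 : tr 1 = 0) (f : ℕ → ℕ) : ¬ I.Assigns f := by
  classical
  intro hf
  have hM := h.matching
  set S := (Finset.range I.R).filter (I.InTree r mL par) with hS
  set T := (Finset.range I.nG).filter fun j => par j ≠ 0 with hT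
  have hrS : r ∈ S := by simp [hS, hr, InTree]
  -- With an empty queue, all edges at tree rows end in reached columns, so an assignment would
  -- embed `S` into `T`.
  have hST : S.card ≤ T.card := by
    refine Finset.card_le_card_of_injOn (fun u => I.col (f u)) (fun u hu => ?_) ?_
    · simp only [hS, Finset.coe_filter, Finset.mem_range, Set.mem_ofPred_eq] at hu
      have hl := hf.lt u hu.1
      simp only [hT, Finset.coe_filter, Finset.mem_range, Set.mem_ofPred_eq]
      refine ⟨I.col_lt _ hl, fun h0 => ?_⟩
      exact hQ.active (f u) hl (by rw [hf.row u hu.1]; exact hu.2) h0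
        (hQ.tournament.root_eq_zero h1 hl)
    · intro u hu u' hu' he
      simp only [hS, Finset.coe_filter, Finset.mem_range, Set.mem_ofPred_eq] at hu hu'
      exact hf.inj u u' hu.1 hu'.1 he
  -- Every reached column is matched, and its mate is a tree row other than the unmatched root. So
  -- `T` is smaller than `S`, against Hall's condition.
  have hTS : T.card ≤ (S.erase r).card := by
    have aux : ∀ j ∈ T, mR j - 1 < I.m ∧ I.col (mR j - 1) = j ∧
        mL (I.row (mR j - 1)) = mR j - 1 + 1 ∧ par j ≠ 0 := by
      intro j hj
      simp only [hT, Finset.mem_filter, Finset.mem_range] at hj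
      have h0 := hQ.matched j hj.2
      obtain ⟨h2, h3, h4⟩ := hM.right j (mR j - 1) (by omega)
      exact ⟨h2, h3, h4, hj.2⟩
    refine Finset.card_le_card_of_injOn (fun j => I.row (mR j - 1)) (fun j hj => ?_) ?_
    · obtain ⟨h2, h3, h4, h5⟩ := aux j hj
      simp only [hS, Finset.coe_erase, Set.mem_sdiff, Finset.coe_filter, Finset.mem_range,
        Set.mem_ofPred_eq, Set.mem_singleton_iff]
      refine ⟨⟨I.row_lt _ h2, .inr ⟨by omega, ?_⟩⟩, fun h6 => ?_⟩
      · rw [h4, Nat.add_sub_cancel, h3]; exact h5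
      · have := (hM.zero _).2 h6.ge
        omega
    · intro j hj j' hj' he
      obtain ⟨h2, h3, h4, h5⟩ := aux j hj
      obtain ⟨h2', h3', h4', h5'⟩ := aux j' hj'
      simp only at he
      rw [he] at h4
      rw [← h3, ← h3']
      congr 1
      omega
  have := Finset.card_erase_lt_of_mem hrS
  omega

/-! ### The queue -/

variable (I) in
open Classical in
/-- A bound on the work that remains for the queue. -/
noncomputable def work (r : ℕ) (mL par tr : ℕ → ℕ) : ℕ :=
  ∑ k ∈ Finset.range I.m,
    if tr (I.m + k) ≠ 0 then 1 else if I.InTree r mL par (I.row k) then 0 else 2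

/-- A column reached through one edge leaves its other edges in the queue. They can be discarded
when they surface, because `active` concerns unreached columns only. -/
theorem Queue.pop (hQ : I.Queue r mL mR par tr yu yw key)
    (h0 : par (I.col (tr 1 - 1)) ≠ 0) {tr' : ℕ → ℕ} (ht : Tournament I.m tr' key 0)
    (htr : ∀ k, k < I.m → tr' (I.m + k) = if k = tr 1 - 1 then 0 else tr (I.m + k)) :
    I.Queue r mL mR par tr' yu yw key := by
  refine ⟨ht, fun k hk hT hp => ?_, fun k hk hk' => ?_, fun k hk hk' => ?_, hQ.matched⟩
  · rw [htr k hk, if_neg (by rintro rfl; exact h0 hp)]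
    exact hQ.active k hk hT hp
  · rw [htr k hk] at hk'
    split_ifs at hk' with h
    · exact absurd rfl hk'
    · exact hQ.inTree k hk hk'
  · rw [htr k hk] at hk'
    split_ifs at hk' with h
    · exact absurd rfl hk'
    · exact hQ.key k hk hk'

/-- An edge has weight two before its row enters the tree, one while it is queued and zero
afterwards. Thus each insertion and each removal is paid by one unit. -/
theorem work_pop (hk0 : ∀ k, k < I.m → tr (I.m + k) ≠ 0 → I.InTree r mL par (I.row k))
    {k : ℕ} (hk : k < I.m) (h1 : tr (I.m + k) ≠ 0) {tr' : ℕ → ℕ}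
    (htr : ∀ k', k' < I.m → tr' (I.m + k') = if k' = k then 0 else tr (I.m + k')) :
    I.work r mL par tr' + 1 = I.work r mL par tr := by
  classical
  have hk' := Finset.mem_range.2 hk
  rw [work, work, ← Finset.add_sum_erase _ _ hk', ← Finset.add_sum_erase _ _ hk',
    htr k hk, if_pos rfl, if_neg (by simp), if_pos (hk0 k hk h1), if_pos h1, zero_add, add_comm]
  congr 1
  refine Finset.sum_congr rfl fun k' hk' => ?_
  rw [Finset.mem_erase, Finset.mem_range] at hk'
  rw [htr k' hk'.2, if_neg hk'.1]

theorem countEdges_eq_sum (row : ℕ → ℕ) (u q : ℕ) :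
    countEdges row u q = ∑ k ∈ Finset.range q, if row k = u then 1 else 0 := by
  induction q with
  | zero => rfl
  | succ q ih => rw [Finset.sum_range_succ, ← ih]; rfl

/-- Adding the row `u` to the tree and its edges to the queue. -/
theorem work_insert {u : ℕ} {par' tr' : ℕ → ℕ}
    (hu : ¬ I.InTree r mL par u)
    (hT : ∀ u', I.InTree r mL par' u' ↔ I.InTree r mL par u' ∨ u' = u)
    (h0 : ∀ k, k < I.m → I.row k = u → tr (I.m + k) = 0)
    (htr : ∀ k, k < I.m → tr' (I.m + k) = if I.row k = u then k + 1 else tr (I.m + k)) :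
    I.work r mL par' tr' + countEdges I.row u I.m = I.work r mL par tr := by
  classical
  rw [countEdges_eq_sum, work, work, ← Finset.sum_add_distrib]
  refine Finset.sum_congr rfl fun k hk => ?_
  have hk := Finset.mem_range.1 hk
  rw [htr k hk]
  by_cases h : I.row k = u
  · simp [h, h0 k hk h, hu]
  · simp [h, hT]

theorem work_le (r : ℕ) (mL par tr : ℕ → ℕ) : I.work r mL par tr ≤ 2 * I.m := by
  classical
  calc I.work r mL par tr ≤ ∑ _k ∈ Finset.range I.m, 2 := by
        refine Finset.sum_le_sum fun k _ => ?_
        split_ifs <;> omega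
    _ = 2 * I.m := by simp [mul_comm]

theorem Queue.start (hp : ∀ j, par j = 0)
    (ht : Tournament I.m tr key 0)
    (htr : ∀ k, k < I.m → tr (I.m + k) = if I.row k = r then k + 1 else 0)
    (hkey : ∀ k, k < I.m → I.row k = r → key k = I.cost k - yu r - yw (I.col k)) :
    I.Queue r mL mR par tr yu yw key := by
  have hT : ∀ u, I.InTree r mL par u ↔ u = r := by
    intro u; simp [InTree, hp]
  refine ⟨ht, fun k hk hT' _ => ?_, fun k hk hk' => ?_, fun k hk hk' _ => ?_,
    fun j hj => absurd (hp j) hj⟩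
  · rw [htr k hk, if_pos ((hT _).1 hT')]; omega
  · rw [htr k hk] at hk'
    split_ifs at hk' with h
    · exact (hT _).2 h
    · exact absurd rfl hk'
  · rw [htr k hk] at hk'
    split_ifs at hk' with h
    · rw [hkey k hk h, h]
    · exact absurd rfl hk'

/-- The queue after the column of the first edge was reached and the edges of its mate were added. -/
theorem Queue.reach (hQ : I.Queue r mL mR par tr yu yw key) (hM : I.Matching r mL mR)
    {j u k₀ : ℕ} (hj : j = I.col k₀) (h0 : par j = 0) (hR : mR j ≠ 0) (hu : u = I.row (mR j - 1))
    {tr' : ℕ → ℕ} {key' yu' yw' : ℕ → ℝ} (ht : Tournament I.m tr' key' 0)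
    (htr : ∀ k, k < I.m → tr' (I.m + k) =
      if I.row k = u then k + 1 else if k = k₀ then 0 else tr (I.m + k))
    (hyu : ∀ u', u' ≠ u → yu' u' = yu u')
    (hyw : ∀ j', j' ≠ j → yw' j' = yw j')
    (hkey : ∀ k, k < I.m → key' k =
      if I.row k = u then I.cost k - yu' u - yw' (I.col k) else key k) :
    I.Queue r mL mR (Function.update par j (k₀ + 1)) tr' yu' yw' key' := by
  have hpar : ∀ j', Function.update par j (k₀ + 1) j' = 0 ↔ j' ≠ j ∧ par j' = 0 := by
    intro j'
    rw [Function.update_apply]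
    split_ifs with h <;> simp [h]
  have hnT : ¬ I.InTree r mL par u := hu ▸ not_inTree_mate hM h0 hR
  have hT : ∀ u', I.InTree r mL (Function.update par j (k₀ + 1)) u' ↔
      I.InTree r mL par u' ∨ u' = u := by
    intro u'
    rw [inTree_update hM, hu]
    simp [hR]
  refine ⟨ht, fun k hk hT' hp => ?_, fun k hk hk' => ?_, fun k hk hk' hp => ?_, fun j' hj' => ?_⟩
  · rw [htr k hk]
    rw [hpar] at hp
    by_cases h : I.row k = u
    · rw [if_pos h]; omega
    -- The removed edge `k₀` ends in `j`, which is now reached, so it is no longer required in the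
    -- queue.
    · rw [if_neg h, if_neg (by rintro rfl; exact hp.1 hj.symm)]
      exact hQ.active k hk (((hT _).1 hT').resolve_right h) hp.2
  · rw [hT]
    rw [htr k hk] at hk'
    split_ifs at hk' with h h2
    · exact .inr h
    · exact absurd rfl hk'
    · exact .inl (hQ.inTree k hk hk')
  · rw [htr k hk] at hk'
    rw [hpar] at hp
    rw [hkey k hk]
    split_ifs at hk' ⊢ with h h2
    · rw [h]
    · exact absurd rfl hk'
    -- Older keys stay valid: only the dual variables stored for `u` and `j` change.
    · rw [hyu _ h, hyw _ hp.1]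
      exact hQ.key k hk hk' hp.2
  · by_cases h : j' = j
    · rw [h]; exact hR
    · exact hQ.matched j' fun h2 => hj' ((hpar j').2 ⟨h, h2⟩)

/-! ### Augmentation -/

variable (I) in
/-- The state of an augmentation of the matching, in which the column `j` is to be matched to the row of
the edge through which it was reached. -/
structure Augmenting (r : ℕ) (mL mR par ord : ℕ → ℕ) (yu yw : ℕ → ℝ) (j : ℕ) : Prop where
  left : ∀ u k, mL u = k + 1 →
    k < I.m ∧ I.row k = u ∧ I.col k ≠ j ∧ mR (I.col k) = k + 1
  zero : ∀ u, mL u = 0 ↔ r ≤ u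
  right : ∀ j' k, j' ≠ j → mR j' = k + 1 → k < I.m ∧ I.col k = j' ∧ mL (I.row k) = k + 1
  tight : ∀ k, k < I.m → mL (I.row k) = k + 1 → yu (I.row k) + yw (I.col k) = I.cost k
  free : ∀ j', j' < I.nG → j' ≠ j → mR j' = 0 → yw j' = 0
  through : ∀ j' k, par j' = k + 1 → k < I.m ∧ I.col k = j' ∧ I.row k ≤ r ∧
    yu (I.row k) + yw j' = I.cost k
  path : ∀ j' k, par j' = k + 1 → ord j' ≤ ord j → mL (I.row k) ≠ 0 →
    par (I.col (mL (I.row k) - 1)) ≠ 0 ∧ ord (I.col (mL (I.row k) - 1)) < ord j'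
  reached : par j ≠ 0

theorem Augmenting.last {j k : ℕ} (h : I.Augmenting r mL mR par ord yu yw j)
    (hk : par j = k + 1) (h0 : mL (I.row k) = 0)
    (hfeas : ∀ k, k < I.m → I.row k < r + 1 → yu (I.row k) + yw (I.col k) ≤ I.cost k)
    (hnonpos : ∀ j, j < I.nG → yw j ≤ 0) :
    I.Matching (r + 1) (Function.update mL (I.row k) (k + 1)) (Function.update mR j (k + 1)) ∧
    I.Dual (r + 1) (Function.update mL (I.row k) (k + 1)) (Function.update mR j (k + 1))
      yu yw := by
  obtain ⟨h1, h2, h3, h4⟩ := h.through j k hk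
  -- Parent rows are at most `r` and unmatched rows at least `r`, so the path has arrived at the
  -- root.
  have hrow : I.row k = r := le_antisymm h3 ((h.zero _).1 h0)
  refine ⟨⟨fun u k' hu => ?_, fun u => ?_, fun j' k' hj' => ?_⟩,
    hfeas, fun k' hk' hk2 => ?_, hnonpos, fun j' hj' hj2 => ?_⟩
  · by_cases hur : u = I.row k
    · subst hur
      rw [Function.update_self] at hu
      obtain rfl : k = k' := by omega
      exact ⟨h1, rfl, by rw [h2, Function.update_self]⟩
    · rw [Function.update_of_ne hur] at hu
      obtain ⟨h5, h6, h7, h8⟩ := h.left u k' hu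
      exact ⟨h5, h6, by rw [Function.update_of_ne h7]; exact h8⟩
  · by_cases hur : u = I.row k
    · subst hur
      simp [hrow]
    · rw [Function.update_of_ne hur, h.zero]
      omega
  · by_cases hjj : j' = j
    · subst hjj
      rw [Function.update_self] at hj'
      obtain rfl : k = k' := by omega
      exact ⟨h1, h2, Function.update_self ..⟩
    · rw [Function.update_of_ne hjj] at hj'
      obtain ⟨h5, h6, h7⟩ := h.right j' k' hjj hj'
      refine ⟨h5, h6, ?_⟩
      rw [Function.update_of_ne]
      · exact h7
      · intro h8
        rw [h8, h0] at h7
        omega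
  · by_cases hur : I.row k' = I.row k
    · rw [hur, Function.update_self] at hk2
      obtain rfl : k = k' := by omega
      rw [h2]; exact h4
    · rw [Function.update_of_ne hur] at hk2
      exact h.tight k' hk' hk2
  · by_cases hjj : j' = j
    · subst hjj
      rw [Function.update_self] at hj2
      omega
    · rw [Function.update_of_ne hjj] at hj2
      exact h.free j' hj' hjj hj2

/-- The parent row exchanges its matched edge for the tight edge `k`. The column it gives up takes
the role of `j`, and its smaller rank makes the process terminate. -/
theorem Augmenting.next {j k : ℕ} (h : I.Augmenting r mL mR par ord yu yw j)
    (hk : par j = k + 1) (h0 : mL (I.row k) ≠ 0) :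
    I.Augmenting r (Function.update mL (I.row k) (k + 1)) (Function.update mR j (k + 1))
      par ord yu yw (I.col (mL (I.row k) - 1)) ∧ ord (I.col (mL (I.row k) - 1)) < ord j := by
  obtain ⟨h1, h2, h3, h4⟩ := h.through j k hk
  obtain ⟨hp1, hp2⟩ := h.path j k hk le_rfl h0
  set u := I.row k with hu
  obtain ⟨q, hq⟩ : ∃ q, mL u = q + 1 := ⟨mL u - 1, by omega⟩
  rw [hq, Nat.add_sub_cancel] at hp1 hp2 ⊢
  obtain ⟨hq1, hq2, hq3, hq4⟩ := h.left u q hq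
  refine ⟨⟨fun u' k' hu' => ?_, fun u' => ?_, fun j' k' hjj hj' => ?_, fun k' hk' hk2 => ?_,
    fun j' hj' hjj hj2 => ?_, h.through, fun j' k' hj' ho hm => ?_, hp1⟩, hp2⟩
  · by_cases hur : u' = u
    · subst hur
      rw [Function.update_self] at hu'
      obtain rfl : k = k' := by omega
      exact ⟨h1, rfl, by rw [h2]; exact hq3.symm, by rw [h2, Function.update_self]⟩
    · rw [Function.update_of_ne hur] at hu'
      obtain ⟨h5, h6, h7, h8⟩ := h.left u' k' hu'
      refine ⟨h5, h6, fun h9 => ?_, by rw [Function.update_of_ne h7]; exact h8⟩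
      rw [h9, hq4] at h8
      obtain rfl : q = k' := by omega
      exact hur (h6.symm.trans hq2)
  · by_cases hur : u' = u
    · subst hur
      rw [Function.update_self, ← h.zero]
      omega
    · rw [Function.update_of_ne hur, h.zero]
  · by_cases hj2 : j' = j
    · subst hj2
      rw [Function.update_self] at hj'
      obtain rfl : k = k' := by omega
      exact ⟨h1, h2, Function.update_self ..⟩
    · rw [Function.update_of_ne hj2] at hj'
      obtain ⟨h5, h6, h7⟩ := h.right j' k' hj2 hj'
      refine ⟨h5, h6, ?_⟩
      rw [Function.update_of_ne]
      · exact h7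
      · intro h8
        rw [h8, hq] at h7
        obtain rfl : q = k' := by omega
        exact hjj h6.symm
  · by_cases hur : I.row k' = u
    · rw [hur, Function.update_self] at hk2
      obtain rfl : k = k' := by omega
      rw [h2]; exact h4
    · rw [Function.update_of_ne hur] at hk2
      exact h.tight k' hk' hk2
  · by_cases hj3 : j' = j
    · subst hj3
      rw [Function.update_self] at hj2
      omega
    · rw [Function.update_of_ne hj3] at hj2
      exact h.free j' hj' hj3 hj2
  -- The old column of `u` precedes every column with parent row `u`. Hence the part of the path
  -- still to be flipped never meets `u` again.
  · have hne : I.row k' ≠ u := by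
      intro h5
      have h6 := h.path j' k' hj' (by omega)
      rw [h5, hq, Nat.add_sub_cancel] at h6
      have := (h6 (by omega)).2
      omega
    rw [Function.update_of_ne hne] at hm ⊢
    exact h.path j' k' hj' (by omega) hm

theorem Search.augmenting (h : I.Search r mL mR par yu yw d ord) {j : ℕ} (hj : par j ≠ 0)
    (h0 : mR j = 0) :
    I.Augmenting r mL mR par ord (I.effU r mL par yu d) (effW par yw d) j := by
  have hM := h.matching
  refine ⟨fun u k hu => ?_, hM.zero, fun j' k hjj hj' => hM.right j' k hj', h.dual.tight,
    fun j' hj' hjj hj2 => h.dual.free j' hj' hj2, fun j' k hk => ?_, fun j' k hk ho hm => ?_, hj⟩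
  · obtain ⟨h1, h2, h3⟩ := hM.left u k hu
    exact ⟨h1, h2, by rintro rfl; omega, h3⟩
  · obtain ⟨h1, h2, h3, h4⟩ := h.through j' k hk
    refine ⟨h1, h2, ?_, h4⟩
    rcases h3 with h3 | ⟨h3, -⟩
    · exact h3.le
    · have := (hM.zero (I.row k)).not.1 h3
      omega
  · refine ⟨?_, h.ordered j' k hk hm⟩
    rcases (h.through j' k hk).2.2.1 with h3 | ⟨-, h3⟩
    · exact absurd ((hM.zero _).2 h3.ge) hm
    · exact h3

end AssignmentProblem

-- With these rules `simp` reduces a claim about a straight-line program to bounds on integers and a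
-- claim about the updated memory.
attribute [simp] NExpr.eval RExpr.eval Test.Holds NExpr.time RExpr.time Test.time wp_skip
  wp_setNat wp_setReal wp_seq wp_ite Memory.setNat_nat Memory.setNat_real Memory.setReal_real
  Memory.setReal_nat

/-! ## Loops over a range -/

/-- Run `P` with cell `0` of integer array `21` equal to `0, 1, …, n - 1`. -/
def forRange (n : NExpr) (P : Program) : Program :=
  .seq (.setNat 21 (.const 0) (.const 0))
    (.while (.natLe (.add (.var 21) (.const 1)) n)
      (.seq P (.setNat 21 (.const 0) (.add (.var 21) (.const 1)))))

/-- A round costs `c` for the body, `e.time + 6` for the test and `6` for the increment. The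
initialization and the failing test make up the final `e.time + 9`. -/
theorem WP.forRange {W : ℕ} {e : NExpr} {n c : ℕ} {P : Program} {s : Memory}
    {Q : ℕ → Memory → Prop} (I : ℕ → Memory → Prop) (h0 : I 0 (s.setNat 21 0 0))
    (hI : ∀ i s, I i s → s.nat 21 0 = i ∧ e.eval s = n) (hn : n ≤ W)
    (hstep : ∀ i s, i < n → I i s → WP W P s fun t s' =>
      t ≤ c ∧ s'.nat 21 0 = i ∧ I (i + 1) (s'.setNat 21 0 (i + 1)))
    (hend : ∀ t s', I n s' → t ≤ (c + e.time + 12) * n + e.time + 9 → Q t s') :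
    WP W (forRange e P) s Q := by
  rw [Rendezvous.forRange, wp_seq, wp_setNat]
  refine ⟨by simp, by simp, ?_⟩
  refine WP.while (fun N s => ∃ i, i ≤ n ∧ I i s ∧ N = (c + e.time + 12) * (n - i))
    (n := (c + e.time + 12) * n) ⟨0, by omega, by simpa using h0, by simp⟩ ?_ ?_
  · rintro N s ⟨i, hin, hi, rfl⟩ hb
    obtain ⟨h1, h2⟩ := hI i s hi
    simp only [Test.Holds, NExpr.eval, h1, h2] at hb
    rw [wp_seq]
    refine (hstep i s (by omega) hi).mono ?_
    rintro t s' ⟨ht, h3, h4⟩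
    simp only [wp_setNat, NExpr.eval, h3]
    refine ⟨by omega, by omega, (c + e.time + 12) * (n - (i + 1)),
      ⟨i + 1, by omega, h4, rfl⟩, ?_⟩
    obtain ⟨q, hq⟩ : ∃ q, n - i = q + 1 := ⟨n - i - 1, by omega⟩
    have hq' : n - (i + 1) = q := by omega
    rw [hq, hq', Nat.mul_succ]
    simp only [Test.time, NExpr.time]
    omega
  · rintro N s' t ⟨i, hin, hi, rfl⟩ hb ht
    obtain ⟨h1, h2⟩ := hI i s' hi
    simp only [Test.Holds, NExpr.eval, h1, h2] at hb
    obtain rfl : i = n := by omega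
    refine hend _ _ hi ?_
    simp only [Test.time, NExpr.time] at ht ⊢
    omega

/-! ## The program

Besides the input and the output, the program uses these integer arrays: `6` and `7`, the adjacency
lists (first edge of a row, next edge of an edge); `8`, the row of an edge; `9`, the tournament tree;
`10` and `11`, the matching (edge of a column, edge of a row); `12`, the edge through which a column was
reached; and the scalars `15` to `23`. Edges are shifted by one where `0` means that there is none. The
real arrays are: `3` and `4`, the dual variables; `5`, the keys of the edges; `6`, the current distance;
`7`, the costs of the edges. -/

/-- Restore the tournament tree on the way from the node in `17` to the root. -/
def fixUp : Program :=
  .while (.natLe (.const 1) (.var 17))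
    (.seq
      (.ite (.natLe (.get 9 (.add (.mul (.const 2) (.var 17)) (.const 1))) (.const 0))
        (.setNat 9 (.var 17) (.get 9 (.mul (.const 2) (.var 17))))
        (.ite (.conj (.natLe (.const 1) (.get 9 (.mul (.const 2) (.var 17))))
            (.realLe (.get 5 (.sub (.get 9 (.mul (.const 2) (.var 17))) (.const 1)))
              (.get 5 (.sub (.get 9 (.add (.mul (.const 2) (.var 17)) (.const 1))) (.const 1)))))
          (.setNat 9 (.var 17) (.get 9 (.mul (.const 2) (.var 17))))
          (.setNat 9 (.var 17) (.get 9 (.add (.mul (.const 2) (.var 17)) (.const 1))))))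
      (.setNat 17 (.const 0) (.div (.var 17) (.const 2))))

theorem wp_fixUp {m L W : ℕ} {s : Memory}
    (hT : Tournament m (s.nat 9) (s.real 5) (s.nat 17 0)) (hi : s.nat 17 0 < m)
    (hL : m ≤ 2 ^ L) (hW : m ≤ W) :
    WP W fixUp s fun t s' => Tournament m (s'.nat 9) (s'.real 5) 0 ∧
      (∀ k, s'.nat 9 (m + k) = s.nat 9 (m + k)) ∧ s.Agree [9, 17] [] s' ∧
      t ≤ 80 * L + 10 := by
  -- The node is halved in every round, so an `l` with node below `2 ^ l` bounds the remaining
  -- levels.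
  refine WP.while (fun N s' => ∃ l, N = 80 * l ∧ s'.nat 17 0 < 2 ^ l ∧ s'.nat 17 0 < m ∧
    Tournament m (s'.nat 9) (s'.real 5) (s'.nat 17 0) ∧
    (∀ k, s'.nat 9 (m + k) = s.nat 9 (m + k)) ∧ s.Agree [9, 17] [] s')
    ⟨L, rfl, by omega, hi, hT, fun _ => rfl, .refl _ _ _⟩ ?_ ?_
  · rintro N s' ⟨l, rfl, h1, h2, h3, h4, h5⟩ hb
    simp only [Test.Holds, NExpr.eval] at hb
    set i := s'.nat 17 0 with hi
    obtain ⟨l, rfl⟩ : ∃ l', l = l' + 1 := by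
      refine ⟨l - 1, ?_⟩
      rcases l with - | l
      · simp at h1; omega
      · rfl
    have hl : i / 2 < 2 ^ l := by rw [pow_succ] at h1; omega
    rw [wp_seq]
    -- All three branches write a child's entry `v` that meets the hypotheses of
    -- `Tournament.repair`.
    refine WP.mono (Q := fun t s'' => t ≤ 60 ∧ ∃ v, s'' = s'.setNat 9 i v ∧
      (v = s'.nat 9 (2 * i) ∨ v = s'.nat 9 (2 * i + 1)) ∧
      (s'.nat 9 (2 * i) ≠ 0 →
        v ≠ 0 ∧ s'.real 5 (v - 1) ≤ s'.real 5 (s'.nat 9 (2 * i) - 1)) ∧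
      (s'.nat 9 (2 * i + 1) ≠ 0 →
        v ≠ 0 ∧ s'.real 5 (v - 1) ≤ s'.real 5 (s'.nat 9 (2 * i + 1) - 1))) ?_ ?_
    · have hle := h3.le (2 * i) (by omega)
      have hle' := h3.le (2 * i + 1) (by omega)
      simp only [wp_ite, wp_setNat, Test.Holds, NExpr.eval, RExpr.eval, NExpr.time,
        RExpr.time, Test.time, ← hi]
      refine ⟨fun h6 => ⟨by omega, by omega, by omega, _, rfl, .inl rfl, fun h => ⟨h, le_rfl⟩,
        fun h => absurd h (by omega)⟩, fun h6 => ⟨fun h7 => ⟨by omega, by omega, by omega,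
        _, rfl, .inl rfl, fun h => ⟨h, le_rfl⟩, fun h => ⟨by omega, h7.2⟩⟩,
        fun h7 => ⟨by omega, by omega, by omega, _, rfl, .inr rfl, fun h => ⟨by omega, ?_⟩,
        fun h => ⟨h, le_rfl⟩⟩⟩⟩
      by_contra h8
      exact h7 ⟨by omega, (not_le.1 h8).le⟩
    · rintro t s'' ⟨ht, v, rfl, h6, h7, h8⟩
      simp [← hi]
      refine ⟨by omega, l, ⟨hl, by omega, h3.repair hb h2 h6 h7 h8, fun k => ?_,
        (h5.setNat (by simp) _ _).setNat (by simp) _ _⟩, by omega⟩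
      rw [Function.update_of_ne (by omega)]
      exact h4 k
  · rintro N s' t ⟨l, rfl, h1, h2, h3, h4, h5⟩ hb ht
    simp only [Test.Holds, NExpr.eval, Test.time, NExpr.time] at hb ht
    have h0 : s'.nat 17 0 = 0 := by omega
    rw [h0] at h3
    exact ⟨h3, h4, h5, by omega⟩

/-- The bounds that the program relies on: `L` for the depth of the tournament tree and `W` for
integers. -/
structure AssignmentProblem.Fits (I : AssignmentProblem) (L W : ℕ) : Prop where
  one_le : 1 ≤ I.m
  pow : I.m ≤ 2 ^ L
  le : 2 * I.m + I.R + I.nG + 2 ≤ W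

/-- The memory holds the assignment problem `I` and its adjacency lists. -/
structure AssignmentProblem.Ready (I : AssignmentProblem) (s : Memory) : Prop where
  R : s.nat 0 0 = I.R
  nG : s.nat 0 2 = I.nG
  m : s.nat 0 3 = I.m
  row : ∀ k, k < I.m → s.nat 8 k = I.row k
  col : ∀ k, k < I.m → s.nat 3 k = I.col k
  cost : ∀ k, k < I.m → s.real 7 k = I.cost k
  first : ∀ u, u < I.R → s.nat 6 u = lastEdge I.row u I.m
  next : ∀ k, k < I.m → s.nat 7 k = lastEdge I.row (I.row k) k

theorem AssignmentProblem.Ready.agree {I : AssignmentProblem} {s s' : Memory} {A B : List ℕ}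
    (h : I.Ready s) (hs : s.Agree A B s') (hA : ∀ k ∈ [0, 3, 6, 7, 8], k ∉ A := by decide)
    (hB : 7 ∉ B := by decide) : I.Ready s' := by
  simp only [List.mem_cons, List.not_mem_nil, or_false, forall_eq_or_imp, forall_eq] at hA
  obtain ⟨h0, h3, h6, h7, h8⟩ := hA
  refine ⟨?_, ?_, ?_, ?_, ?_, ?_, ?_, ?_⟩
  · rw [hs.nat _ h0]; exact h.R
  · rw [hs.nat _ h0]; exact h.nG
  · rw [hs.nat _ h0]; exact h.m
  · rw [hs.nat _ h8]; exact h.row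
  · rw [hs.nat _ h3]; exact h.col
  · rw [hs.real _ hB]; exact h.cost
  · rw [hs.nat _ h6]; exact h.first
  · rw [hs.nat _ h7]; exact h.next

/-! ### Queue operations -/

/-- Insert the edges of the row in `15` into the tournament tree. -/
def pushEdges : Program :=
  .seq (.setNat 16 (.const 0) (.get 6 (.var 15)))
    (.while (.natLe (.const 1) (.var 16))
      (.seq
        (.setReal 5 (.sub (.var 16) (.const 1))
          (.sub (.sub (.get 7 (.sub (.var 16) (.const 1))) (.get 3 (.var 15)))
            (.get 4 (.get 3 (.sub (.var 16) (.const 1))))))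
        (.seq (.setNat 9 (.add (.get 0 (.const 3)) (.sub (.var 16) (.const 1))) (.var 16))
          (.seq (.setNat 17 (.const 0)
              (.div (.add (.get 0 (.const 3)) (.sub (.var 16) (.const 1))) (.const 2)))
            (.seq fixUp (.setNat 16 (.const 0) (.get 7 (.sub (.var 16) (.const 1)))))))))

theorem wp_pushEdges {I : AssignmentProblem} {L W : ℕ} (hF : I.Fits L W) {s : Memory}
    (hR : I.Ready s) {u : ℕ} (hu : s.nat 15 0 = u) (huR : u < I.R)
    (hT : Tournament I.m (s.nat 9) (s.real 5) 0)
    (h0 : ∀ k, k < I.m → I.row k = u → s.nat 9 (I.m + k) = 0) :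
    WP W pushEdges s fun t s' => Tournament I.m (s'.nat 9) (s'.real 5) 0 ∧
      (∀ k, k < I.m → s'.nat 9 (I.m + k) =
        if I.row k = u then k + 1 else s.nat 9 (I.m + k)) ∧
      (∀ k, k < I.m → s'.real 5 k =
        if I.row k = u then I.cost k - s.real 3 u - s.real 4 (I.col k) else s.real 5 k) ∧
      s.Agree [9, 16, 17] [5] s' ∧ t ≤ (80 * L + 100) * countEdges I.row u I.m + 20 := by
  have hm := hF.one_le
  have hW := hF.le
  have hfirst := hR.first u huR
  have hlast := lastEdge_le I.row u I.m
  rw [pushEdges, wp_seq, wp_setNat]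
  refine ⟨by simp, by simp [hu, hfirst]; omega, ?_⟩
  simp only [NExpr.eval, hu, hfirst]
  -- The list of `u` is traversed downwards: among the edges of `u`, exactly those numbered `q` or
  -- more have been inserted, and the time budget counts those below `q`.
  refine WP.while (fun N s' => ∃ q, q ≤ I.m ∧ N = (80 * L + 100) * countEdges I.row u q ∧
    s'.nat 16 0 = lastEdge I.row u q ∧ Tournament I.m (s'.nat 9) (s'.real 5) 0 ∧
    (∀ k, k < I.m → s'.nat 9 (I.m + k) =
        if I.row k = u ∧ q ≤ k then k + 1 else s.nat 9 (I.m + k)) ∧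
      (∀ k, k < I.m → s'.real 5 k = if I.row k = u ∧ q ≤ k then
        I.cost k - s.real 3 u - s.real 4 (I.col k) else s.real 5 k) ∧
      s.Agree [9, 16, 17] [5] s')
    ⟨I.m, le_rfl, rfl, by simp, by simpa using hT, fun k hk => ?_, fun k hk => ?_,
      (Memory.Agree.refl _ _ _).setNat (by simp) _ _⟩ ?_ ?_
  · rw [if_neg (by omega)]; simp
  · rw [if_neg (by omega)]; simp
  · rintro N s₁ ⟨q, hq, rfl, hp, hT₁, htr, hkey, hA⟩ hb
    have hR₁ : I.Ready s₁ := hR.agree hA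
    have hu₁ : s₁.nat 15 0 = u := by rw [hA.nat 15 (by simp)]; exact hu
    have h3 : s₁.real 3 = s.real 3 := hA.real 3 (by simp)
    have h4 : s₁.real 4 = s.real 4 := hA.real 4 (by simp)
    simp only [Test.Holds, NExpr.eval, hp] at hb
    obtain ⟨hrow, hcount⟩ := lastEdge_spec (row := I.row) (u := u) (q := q) (by omega)
    have hle := lastEdge_le I.row u q
    obtain ⟨k, hk⟩ : ∃ k, lastEdge I.row u q = k + 1 := ⟨lastEdge I.row u q - 1, by omega⟩
    rw [hk, Nat.add_sub_cancel] at hrow hcount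
    have hkm : k < I.m := by omega
    have hmk : I.m + k ≠ k := by omega
    have hl0 : s₁.nat 9 (I.m + k) = 0 := by
      rw [htr k hkm, if_neg (by omega)]; exact h0 k hkm hrow
    rw [hk] at hp
    have hTi := hT₁.insert_leaf hkm hl0 (I.cost k - s.real 3 u - s.real 4 (I.col k))
    simp [hp, hu₁, hR₁.m, hR₁.cost k hkm, hR₁.col k hkm, h3, h4]
    refine ⟨by omega, by omega, by omega, by omega, ?_⟩
    refine (wp_fixUp (L := L) (m := I.m) (by simpa using hTi) (by simp; omega) hF.pow
      (by omega)).mono ?_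
    rintro t s₂ ⟨hT₂, htr₂, hA₂, ht⟩
    simp at htr₂
    have hp₂ : s₂.nat 16 0 = k + 1 := by rw [hA₂.nat 16 (by simp)]; simpa using hp
    have hn₂ : s₂.nat 7 k = lastEdge I.row u k := by
      rw [hA₂.nat 7 (by simp)]; simp [hR₁.next k hkm, hrow]
    have hr₂ : s₂.real 5 =
        Function.update (s₁.real 5) k (I.cost k - s.real 3 u - s.real 4 (I.col k)) := by
      rw [hA₂.real 5 (by simp)]; simp
    have hlk := lastEdge_le I.row u k
    have hcases : ∀ k', k' < I.m → k' ≠ k →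
        ((I.row k' = u ∧ k ≤ k') ↔ (I.row k' = u ∧ q ≤ k')) := by
      intro k' hk' hne
      refine ⟨fun h => ⟨h.1, ?_⟩, fun h => ⟨h.1, by omega⟩⟩
      by_contra hlt
      exact row_ne_of_lastEdge_le (not_le.1 hlt) (by omega) h.1
    simp [hp₂, hn₂]
    refine ⟨by omega, k, ⟨hkm.le, rfl, hT₂, fun k' hk' => ?_, fun k' hk' => ?_, ?_⟩, ?_⟩
    · rw [htr₂]
      by_cases hkk : k' = k
      · subst hkk
        simp [hrow]
      · rw [Function.update_of_ne (by omega), htr k' hk']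
        exact if_congr (hcases k' hk' hkk).symm rfl rfl
    · rw [hr₂]
      by_cases hkk : k' = k
      · subst hkk
        simp [hrow]
      · rw [Function.update_of_ne hkk, hkey k' hk']
        exact if_congr (hcases k' hk' hkk).symm rfl rfl
    · refine (hA.trans (.trans (.setNat (.setNat (.setReal (.refl _ _ _) ?_ _ _) ?_ _ _) ?_ _ _)
        (hA₂.mono ?_ ?_))).setNat ?_ _ _
      all_goals simp
    · rw [hcount, Nat.mul_succ]
      omega
  · rintro N s₁ t ⟨q, hq, rfl, hp, hT₁, htr, hkey, hA⟩ hb ht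
    simp only [Test.Holds, NExpr.eval, hp, Test.time, NExpr.time] at hb ht
    have hiff : ∀ k, k < I.m → ((I.row k = u ∧ q ≤ k) ↔ I.row k = u) := by
      intro k hk
      refine ⟨fun h => h.1, fun h => ⟨h, ?_⟩⟩
      by_contra hlt
      exact row_ne_of_lastEdge_le (not_le.1 hlt) (by omega) h
    refine ⟨hT₁, fun k hk => ?_, fun k hk => ?_, hA, ?_⟩
    · rw [htr k hk]; exact if_congr (hiff k hk) rfl rfl
    · rw [hkey k hk]; exact if_congr (hiff k hk) rfl rfl
    · simp only [NExpr.time]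
      omega

/-- Remove the first edge of the tournament tree, store it in `23`, and store its key. -/
def popEdge : Program :=
  .seq (.setNat 23 (.const 0) (.get 9 (.const 1)))
    (.seq (.setReal 6 (.const 0) (.get 5 (.sub (.var 23) (.const 1))))
      (.seq (.setNat 9 (.add (.get 0 (.const 3)) (.sub (.var 23) (.const 1))) (.const 0))
        (.seq (.setNat 17 (.const 0)
            (.div (.add (.get 0 (.const 3)) (.sub (.var 23) (.const 1))) (.const 2)))
          fixUp)))

theorem wp_popEdge {I : AssignmentProblem} {L W : ℕ} (hF : I.Fits L W) {s : Memory}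
    (hR : I.Ready s) (hT : Tournament I.m (s.nat 9) (s.real 5) 0) {k : ℕ}
    (h1 : s.nat 9 1 = k + 1) :
    WP W popEdge s fun t s' => Tournament I.m (s'.nat 9) (s'.real 5) 0 ∧
      (∀ k', k' < I.m → s'.nat 9 (I.m + k') = if k' = k then 0 else s.nat 9 (I.m + k')) ∧
      s'.nat 23 0 = k + 1 ∧ s'.real 6 0 = s.real 5 k ∧
      s.Agree [9, 17, 23] [6] s' ∧ t ≤ 80 * L + 100 := by
  have hm := hF.one_le
  have hW := hF.le
  have hk := (hT.root_spec hm (by omega)).1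
  rw [h1, Nat.add_sub_cancel] at hk
  simp [popEdge, h1, hR.m]
  refine ⟨by omega, by omega, by omega, ?_⟩
  refine (wp_fixUp (L := L) (m := I.m) (by simpa using hT.erase_leaf k) (by simp; omega) hF.pow
    (by omega)).mono ?_
  rintro t s' ⟨hT', htr, hA, ht⟩
  refine ⟨hT', fun k' hk' => ?_, ?_, ?_, ?_, by omega⟩
  · rw [htr]
    simp [Function.update_apply]
  · rw [hA.nat 23 (by simp)]; simp
  · rw [hA.real 6 (by simp)]; simp
  · refine .trans (.setNat (.setNat (.setReal (.setNat (.refl _ _ _) ?_ _ _) ?_ _ _) ?_ _ _) ?_ _ _)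
      (hA.mono ?_ ?_)
    all_goals simp

/-! ### The search for an augmenting path -/

/-- Reach the column of the edge in `23`; add its mate to the tree, or set `19` to `1` if it is free. -/
def visit : Program :=
  .seq (.setNat 20 (.const 0) (.get 3 (.sub (.var 23) (.const 1))))
    (.seq (.setNat 12 (.var 20) (.var 23))
      (.seq (.setReal 4 (.var 20) (.add (.get 4 (.var 20)) (.get 6 (.const 0))))
        (.ite (.natLe (.get 10 (.var 20)) (.const 0))
          (.setNat 19 (.const 0) (.const 1))
          (.seq (.setNat 15 (.const 0) (.get 8 (.sub (.get 10 (.var 20)) (.const 1))))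
            (.seq (.setReal 3 (.var 15) (.sub (.get 3 (.var 15)) (.get 6 (.const 0))))
              pushEdges)))))

/-- Process the first edge of the queue, or set `19` to `2` if there is none. -/
def searchStep : Program :=
  .ite (.natLe (.get 9 (.const 1)) (.const 0))
    (.setNat 19 (.const 0) (.const 2))
    (.seq popEdge
      (.ite (.natLe (.get 12 (.get 3 (.sub (.var 23) (.const 1)))) (.const 0)) visit .skip))

/-- Search for an augmenting path while `19` is `0`. -/
def search : Program := .while (.natLe (.var 19) (.const 0)) searchStep

namespace AssignmentProblem

/-- A search is going on in the memory. -/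
structure Searching (I : AssignmentProblem) (r : ℕ) (s : Memory) : Prop where
  search : ∃ d ord, I.Search r (s.nat 11) (s.nat 10) (s.nat 12) (s.real 3) (s.real 4) d ord
  queue : I.Queue r (s.nat 11) (s.nat 10) (s.nat 12) (s.nat 9) (s.real 3) (s.real 4) (s.real 5)

/-- A search has reached a free column. -/
structure Found (I : AssignmentProblem) (r : ℕ) (s : Memory) : Prop where
  search : ∃ ord,
    I.Search r (s.nat 11) (s.nat 10) (s.nat 12) (s.real 3) (s.real 4) (s.real 6 0) ord
  reached : s.nat 12 (s.nat 20 0) ≠ 0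
  free : s.nat 10 (s.nat 20 0) = 0

end AssignmentProblem

/-- The queue invariant is assumed for the tree `tr` from before the removal of `k`. Between that
removal and the reaching of its column, `active` fails at `k`. -/
theorem wp_visit {I : AssignmentProblem} {L W r : ℕ} (hF : I.Fits L W) {s : Memory}
    (hR : I.Ready s) {k : ℕ} {ord tr : ℕ → ℕ}
    (hS : I.Search r (s.nat 11) (s.nat 10) (s.nat 12) (s.real 3) (s.real 4) (s.real 6 0) ord)
    (hQ : I.Queue r (s.nat 11) (s.nat 10) (s.nat 12) tr (s.real 3) (s.real 4) (s.real 5))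
    (hk : k < I.m) (hkey : s.real 5 k = s.real 6 0) (h1 : tr (I.m + k) ≠ 0)
    (h23 : s.nat 23 0 = k + 1) (h19 : s.nat 19 0 = 0) (hp : s.nat 12 (I.col k) = 0)
    (hT : Tournament I.m (s.nat 9) (s.real 5) 0)
    (htr : ∀ k', k' < I.m → s.nat 9 (I.m + k') = if k' = k then 0 else tr (I.m + k')) :
    WP W visit s fun t s' => s.Agree [9, 12, 15, 16, 17, 19, 20] [3, 4, 5] s' ∧
      ((s'.nat 19 0 = 0 ∧ I.Searching r s' ∧ ∃ q,
          I.work r (s'.nat 11) (s'.nat 12) (s'.nat 9) + q + 1 =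
            I.work r (s.nat 11) (s.nat 12) tr ∧ t ≤ (80 * L + 100) * q + 100) ∨
        (s'.nat 19 0 = 1 ∧ I.Found r s' ∧ t ≤ 100)) := by
  have hm := hF.one_le
  have hW := hF.le
  have hM := hS.matching
  have hc := I.col_lt k hk
  have hkT := hQ.inTree k hk h1
  have hd := hQ.key k hk h1 hp
  rw [hkey] at hd
  simp [visit, h23, hR.col k hk]
  refine ⟨by omega, by omega, by omega, fun hfree => ⟨by omega, ?_, ?_⟩, fun hfree => ?_⟩
  · refine .setNat (.setReal (.setNat (.setNat (.refl _ _ _) ?_ _ _) ?_ _ _) ?_ _ _) ?_ _ _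
    all_goals simp
  · refine ⟨?_, by simp, by simpa using hfree⟩
    simpa using hS.reach hk hkT hp hd.symm (yu' := s.real 3) (by simp [hfree])
  · obtain ⟨hk2, hcol2, hmL2⟩ := hM.right (I.col k) (s.nat 10 (I.col k) - 1) (by omega)
    set j := I.col k with hj
    set u := I.row (s.nat 10 j - 1) with hu
    have huR : u < I.R := I.row_lt _ hk2
    have hnT : ¬ I.InTree r (s.nat 11) (s.nat 12) u := AssignmentProblem.not_inTree_mate hM hp hfree
    obtain ⟨ord', hS'⟩ := hS.reach hk hkT hp hd.symm
      (yu' := Function.update (s.real 3) u (s.real 3 u - s.real 6 0)) (by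
        intro u'
        rw [Function.update_apply]
        by_cases h : u' = u <;> simp [h, hfree, ← hj, ← hu])
    simp [hR.row _ hk2, ← hu]
    refine ⟨by omega, ?_⟩
    -- The mate is not yet in the tree, so none of its edges can be queued.
    have hleaf : ∀ k', k' < I.m → I.row k' = u → tr (I.m + k') = 0 := by
      intro k' hk' hr'
      by_contra h
      exact hnT (hr' ▸ hQ.inTree k' hk' h)
    refine (wp_pushEdges hF (u := u) (hR.agree (A := [15, 12, 20]) (B := [3, 4]) ?_) ?_ huR
      ?_ (fun k' hk' hr' => ?_)).mono ?_
    · refine .setReal (.setNat (.setReal (.setNat (.setNat (.refl _ _ _) ?_ _ _) ?_ _ _)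
        ?_ _ _) ?_ _ _) ?_ _ _
      all_goals simp
    · simp
    · simpa using hT
    · simp [htr k' hk', hleaf k' hk' hr']
    rintro t s' ⟨hT', htr', hkey', hA, ht⟩
    simp at htr' hkey'
    have e11 : s'.nat 11 = s.nat 11 := by rw [hA.nat 11 (by simp)]; simp
    have e10 : s'.nat 10 = s.nat 10 := by rw [hA.nat 10 (by simp)]; simp
    have e12 : s'.nat 12 = Function.update (s.nat 12) j (k + 1) := by
      rw [hA.nat 12 (by simp)]; simp
    have e3 : s'.real 3 = Function.update (s.real 3) u (s.real 3 u - s.real 6 0) := by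
      rw [hA.real 3 (by simp)]; simp
    have e4 : s'.real 4 = Function.update (s.real 4) j (s.real 4 j + s.real 6 0) := by
      rw [hA.real 4 (by simp)]; simp
    have e19 : s'.nat 19 0 = 0 := by rw [hA.nat 19 (by simp)]; simpa using h19
    have hTree : ∀ u', I.InTree r (s.nat 11) (Function.update (s.nat 12) j (k + 1)) u' ↔
        I.InTree r (s.nat 11) (s.nat 12) u' ∨ u' = u := by
      intro u'
      rw [AssignmentProblem.inTree_update hM]
      simp [hfree, ← hu]
    have hru : I.row k ≠ u := fun h => hnT (h ▸ hkT)
    refine ⟨?_, .inl ⟨e19, ⟨⟨s.real 6 0, ord', ?_⟩, ?_⟩, countEdges I.row u I.m, ?_, by omega⟩⟩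
    · refine .trans (.setReal (.setNat (.setReal (.setNat (.setNat (.refl _ _ _) ?_ _ _) ?_ _ _)
        ?_ _ _) ?_ _ _) ?_ _ _) (hA.mono ?_ ?_)
      all_goals simp
    · rw [e11, e10, e12, e3, e4]; exact hS'
    · rw [e11, e10, e12]
      refine hQ.reach hM hj hp hfree hu hT' (fun k' hk' => ?_) (fun u' hu' => ?_)
        (fun j' hj' => ?_) (fun k' hk' => ?_)
      · rw [htr' k' hk', htr k' hk']
      · rw [e3, Function.update_of_ne hu']
      · rw [e4, Function.update_of_ne hj']
      · rw [hkey' k' hk', e3, e4, Function.update_self]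
    -- The work is compared through an intermediate tree in which `k` is put back: inserting the
    -- edges of `u` leads to it, and removing `k` leads on to the actual tree.
    · have w1 := AssignmentProblem.work_insert hnT hTree hleaf
        (tr' := fun i => if i = I.m + k then tr i else s'.nat 9 i) (fun k' hk' => ?_)
      · have w2 := AssignmentProblem.work_pop (I := I) (r := r) (mL := s.nat 11)
          (par := Function.update (s.nat 12) j (k + 1))
          (tr := fun i => if i = I.m + k then tr i else s'.nat 9 i) (tr' := s'.nat 9) (k := k)
          (fun k' hk' h => ?_) hk (by simpa using h1) (fun k' hk' => ?_)
        · rw [e11, e12]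
          omega
        · rw [hTree]
          simp only [Nat.add_left_cancel_iff] at h
          split_ifs at h with h2
          · exact .inl (h2 ▸ hkT)
          · rw [htr' k' hk'] at h
            split_ifs at h with h3
            · exact .inr h3
            · rw [htr k' hk', if_neg h2] at h
              exact .inl (hQ.inTree k' hk' h)
        · by_cases h2 : k' = k
          · subst h2
            rw [htr' k' hk', if_neg hru, htr k' hk']
            simp
          · simp [h2]
      · simp only [Nat.add_left_cancel_iff]
        by_cases h2 : k' = k
        · subst h2
          rw [if_pos rfl, if_neg hru]
        · rw [if_neg h2, htr' k' hk', htr k' hk', if_neg h2]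

theorem wp_searchStep {I : AssignmentProblem} {L W r : ℕ} (hF : I.Fits L W) (hr : r < I.R)
    {s : Memory} (hR : I.Ready s) (hS : I.Searching r s) (h19 : s.nat 19 0 = 0) :
    WP W searchStep s fun t s' =>
      s.Agree [9, 12, 15, 16, 17, 19, 20, 23] [3, 4, 5, 6] s' ∧
      ((s'.nat 19 0 = 0 ∧ I.Searching r s' ∧ ∃ q,
          I.work r (s'.nat 11) (s'.nat 12) (s'.nat 9) + q + 1 =
            I.work r (s.nat 11) (s.nat 12) (s.nat 9) ∧
          t ≤ (80 * L + 100) * q + (80 * L + 300)) ∨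
        (s'.nat 19 0 = 1 ∧ I.Found r s' ∧ t ≤ 80 * L + 300) ∨
        (s'.nat 19 0 = 2 ∧ (∀ f, ¬ I.Assigns f) ∧ t ≤ 80 * L + 300)) := by
  have hm := hF.one_le
  have hW := hF.le
  obtain ⟨⟨d, ord, hS⟩, hQ⟩ := hS
  simp only [searchStep, wp_ite, wp_setNat, wp_seq, Test.Holds, NExpr.eval, NExpr.time, Test.time]
  refine ⟨fun h1 => ⟨by omega, by omega, (Memory.Agree.refl _ _ _).setNat (by simp) _ _,
    .inr (.inr ⟨by simp, hS.not_assigns hr hQ (by omega), by omega⟩)⟩, fun h1 => ?_⟩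
  obtain ⟨k, hk⟩ : ∃ k, s.nat 9 1 = k + 1 := ⟨s.nat 9 1 - 1, by omega⟩
  obtain ⟨hkm, hk1, -⟩ := hQ.tournament.root_spec hm (by omega)
  have hadv := hS.advance_root hQ hm (by omega)
  rw [hk, Nat.add_sub_cancel] at hkm hk1 hadv
  refine (wp_popEdge hF hR hQ.tournament hk).mono ?_
  rintro t s₁ ⟨hT, htr, h23, h6, hA, ht⟩
  have hR₁ : I.Ready s₁ := hR.agree hA
  have e10 : s₁.nat 10 = s.nat 10 := hA.nat 10 (by simp)
  have e11 : s₁.nat 11 = s.nat 11 := hA.nat 11 (by simp)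
  have e12 : s₁.nat 12 = s.nat 12 := hA.nat 12 (by simp)
  have e19 : s₁.nat 19 = s.nat 19 := hA.nat 19 (by simp)
  have e3 : s₁.real 3 = s.real 3 := hA.real 3 (by simp)
  have e4 : s₁.real 4 = s.real 4 := hA.real 4 (by simp)
  have e5 : s₁.real 5 = s.real 5 := hA.real 5 (by simp)
  simp only [h23, Nat.add_sub_cancel, hR₁.col k hkm, e12, wp_skip]
  refine ⟨fun hp => ?_, fun hp => ?_⟩
  · have hp : s.nat 12 (I.col k) = 0 := by omega
    have hS₁ := hadv hp
    rw [← h6] at hS₁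
    refine (wp_visit hF hR₁ (r := r) (ord := ord) (tr := s.nat 9) (k := k)
      (by rw [e11, e10, e12, e3, e4]; exact hS₁) (by rw [e11, e10, e12, e3, e4, e5]; exact hQ)
      hkm (by rw [h6, e5]) hk1 h23 (by rw [e19, h19]) (by rw [e12, hp]) hT htr).mono ?_
    rintro t' s' ⟨hA', h | h⟩
    · obtain ⟨h, hS', q, hq, ht'⟩ := h
      rw [e11, e12] at hq
      exact ⟨(hA.mono (by simp) (by simp)).trans (hA'.mono (by simp) (by simp)),
        .inl ⟨h, hS', q, hq, by omega⟩⟩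
    · obtain ⟨h, hS', ht'⟩ := h
      exact ⟨(hA.mono (by simp) (by simp)).trans (hA'.mono (by simp) (by simp)),
        .inr (.inl ⟨h, hS', by omega⟩)⟩
  -- For an outdated edge the invariant keeps its old `d`, although the stored distance has been
  -- overwritten.
  · have hp : s.nat 12 (I.col k) ≠ 0 := by omega
    have hQ' := hQ.pop (by rw [hk, Nat.add_sub_cancel]; exact hp) (tr' := s₁.nat 9)
      (by rw [← e5]; exact hT) (by rw [hk, Nat.add_sub_cancel]; exact htr)
    refine ⟨hA.mono (by simp) (by simp), .inl ⟨by rw [e19, h19], ⟨⟨d, ord, ?_⟩, ?_⟩, 0, ?_, by omega⟩⟩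
    · rw [e11, e10, e12, e3, e4]; exact hS
    · rw [e11, e10, e12, e3, e4, e5]; exact hQ'
    · rw [e11]
      exact AssignmentProblem.work_pop hQ.inTree hkm hk1 htr

theorem wp_search {I : AssignmentProblem} {L W r : ℕ} (hF : I.Fits L W) (hr : r < I.R)
    {s : Memory} (hR : I.Ready s) (hS : I.Searching r s) (h19 : s.nat 19 0 = 0) :
    WP W search s fun t s' =>
      s.Agree [9, 12, 15, 16, 17, 19, 20, 23] [3, 4, 5, 6] s' ∧
      t ≤ (80 * L + 400) * (2 * I.m + 2) ∧
      ((s'.nat 19 0 = 1 ∧ I.Found r s') ∨ (s'.nat 19 0 = 2 ∧ ∀ f, ¬ I.Assigns f)) := by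
  -- Each unit of work pays for one queue operation; the extra unit pays for the step that ends the
  -- search.
  refine WP.while (fun N s' => s.Agree [9, 12, 15, 16, 17, 19, 20, 23] [3, 4, 5, 6] s' ∧
    ((s'.nat 19 0 = 0 ∧ I.Searching r s' ∧
      N = (80 * L + 400) * (I.work r (s'.nat 11) (s'.nat 12) (s'.nat 9) + 1)) ∨
      (N = 0 ∧ ((s'.nat 19 0 = 1 ∧ I.Found r s') ∨
        (s'.nat 19 0 = 2 ∧ ∀ f, ¬ I.Assigns f)))) )
    ⟨.refl _ _ _, .inl ⟨h19, hS, rfl⟩⟩ ?_ ?_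
  · rintro N s₁ ⟨hA, h⟩ hb
    simp only [Test.Holds, NExpr.eval] at hb
    rcases h with ⟨h1, h2, rfl⟩ | ⟨-, h | h⟩
    · refine (wp_searchStep hF hr (hR.agree hA) h2 h1).mono ?_
      simp only [Test.time, NExpr.time]
      rintro t s' ⟨hA', ⟨h, hS', q, hq, ht⟩ | ⟨h, hS', ht⟩ | ⟨h, hS', ht⟩⟩
      · refine ⟨_, ⟨hA.trans hA', .inl ⟨h, hS', rfl⟩⟩, ?_⟩
        rw [← hq]
        have := Nat.mul_le_mul_right q (show 80 * L + 100 ≤ 80 * L + 400 by omega)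
        simp only [Nat.mul_add (80 * L + 400)]
        omega
      · refine ⟨0, ⟨hA.trans hA', .inr ⟨rfl, .inl ⟨h, hS'⟩⟩⟩, ?_⟩
        rw [Nat.mul_add]
        omega
      · refine ⟨0, ⟨hA.trans hA', .inr ⟨rfl, .inr ⟨h, hS'⟩⟩⟩, ?_⟩
        rw [Nat.mul_add]
        omega
    · omega
    · omega
  · rintro N s' t ⟨hA, h⟩ hb ht
    simp only [Test.Holds, NExpr.eval, Test.time, NExpr.time] at hb ht
    rcases h with ⟨h1, h2, rfl⟩ | ⟨rfl, h⟩
    · omega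
    · refine ⟨hA, ?_, h⟩
      have h1 := Nat.mul_le_mul_left (80 * L + 400)
        (Nat.add_le_add_right (AssignmentProblem.work_le (I := I) r (s.nat 11) (s.nat 12)
          (s.nat 9)) 1)
      generalize I.work r (s.nat 11) (s.nat 12) (s.nat 9) = w at h1 ht
      obtain ⟨c, hc⟩ : ∃ c, c = 80 * L + 400 := ⟨_, rfl⟩
      rw [← hc] at h1 ht ⊢
      simp only [Nat.mul_add c] at h1 ht ⊢
      omega

/-! ### Clearing arrays, updating the dual variables, flipping the path -/

theorem wp_clear {W k n : ℕ} {e : NExpr} {s : Memory} (hk : k ≠ 21) (hn : n ≤ W)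
    (he : ∀ s', s.Agree [k, 21] [] s' → e.eval s' = n) :
    WP W (forRange e (.setNat k (.var 21) (.const 0))) s fun t s' =>
      (∀ i, i < n → s'.nat k i = 0) ∧ (∀ i, n ≤ i → s'.nat k i = s.nat k i) ∧
      s.Agree [k, 21] [] s' ∧ t ≤ (e.time + 16) * n + e.time + 9 := by
  refine WP.forRange (n := n) (c := 4) (fun i s' => s'.nat 21 0 = i ∧ s.Agree [k, 21] [] s' ∧
    (∀ j, j < i → s'.nat k j = 0) ∧ (∀ j, i ≤ j → s'.nat k j = s.nat k j))
    ⟨by simp, (Memory.Agree.refl _ _ _).setNat (by simp) _ _, by simp, by simp [hk]⟩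
    (fun i s' h => ⟨h.1, he s' h.2.1⟩) hn ?_ ?_
  · rintro i s' hi ⟨h1, h2, h3, h4⟩
    have hk' : (21 : ℕ) ≠ k := Ne.symm hk
    simp [h1, hk, hk']
    refine ⟨by omega, (h2.setNat (by simp) _ _).setNat (by simp) _ _, fun j hj => ?_,
      fun j hj => ?_⟩
    · rcases hj.lt_or_eq with hj | rfl
      · rw [Function.update_of_ne (by omega)]; exact h3 j hj
      · simp
    · rw [Function.update_of_ne (by omega)]; exact h4 j (by omega)
  · rintro t s' ⟨h1, h2, h3, h4⟩ ht
    refine ⟨h3, h4, h2, ht.trans (le_of_eq ?_)⟩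
    ring

/-- Turn the stored dual variables into the real ones at the end of a search. -/
def dualUpdate : Program :=
  .seq (.setReal 3 (.var 18) (.add (.get 3 (.var 18)) (.get 6 (.const 0))))
    (forRange (.get 0 (.const 2))
      (.ite (.natLe (.get 12 (.var 21)) (.const 0)) .skip
        (.seq (.setReal 4 (.var 21) (.sub (.get 4 (.var 21)) (.get 6 (.const 0))))
          (.ite (.natLe (.get 10 (.var 21)) (.const 0)) .skip
            (.setReal 3 (.get 8 (.sub (.get 10 (.var 21)) (.const 1)))
              (.add (.get 3 (.get 8 (.sub (.get 10 (.var 21)) (.const 1))))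
                (.get 6 (.const 0))))))))

/-- A tree row other than the root is the mate of exactly one reached column, so one pass over the
columns corrects each such row once; the root is treated separately. -/
theorem wp_dualUpdate {I : AssignmentProblem} {L W r : ℕ} (hF : I.Fits L W) (hr : r < I.R)
    {s : Memory} (hR : I.Ready s) (hM : I.Matching r (s.nat 11) (s.nat 10))
    (h18 : s.nat 18 0 = r) :
    WP W dualUpdate s fun t s' => s.Agree [21] [3, 4] s' ∧
      (∀ u, s'.real 3 u = I.effU r (s.nat 11) (s.nat 12) (s.real 3) (s.real 6 0) u) ∧
      (∀ j, j < I.nG → s'.real 4 j =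
        AssignmentProblem.effW (s.nat 12) (s.real 4) (s.real 6 0) j) ∧
      t ≤ 100 * (I.nG + 1) := by
  classical
  have hW := hF.le
  obtain ⟨mL, hmL⟩ : ∃ mL, mL = s.nat 11 := ⟨_, rfl⟩
  obtain ⟨mR, hmR⟩ : ∃ mR, mR = s.nat 10 := ⟨_, rfl⟩
  obtain ⟨par, hpar⟩ : ∃ par, par = s.nat 12 := ⟨_, rfl⟩
  obtain ⟨d, hd⟩ : ∃ d, d = s.real 6 0 := ⟨_, rfl⟩
  rw [← hmL, ← hmR] at hM
  rw [← hmL, ← hpar, ← hd]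
  simp [dualUpdate, h18, ← hd]
  refine ⟨by omega, WP.forRange (n := I.nG) (c := 60) (fun i s' => s'.nat 21 0 = i ∧
    s.Agree [21] [3, 4] s' ∧
    (∀ j, s'.real 4 j = if par j ≠ 0 ∧ j < i then s.real 4 j - d else s.real 4 j) ∧
    (∀ u, s'.real 3 u = if u = r ∨ (mL u ≠ 0 ∧ par (I.col (mL u - 1)) ≠ 0 ∧
      I.col (mL u - 1) < i) then s.real 3 u + d else s.real 3 u))
    ⟨by simp, ?_, fun j => by simp, fun u => ?_⟩ (fun i s' h => ⟨h.1, ?_⟩) (by omega) ?_ ?_⟩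
  · exact .setNat (.setReal (.refl _ _ _) (by simp) _ _) (by simp) _ _
  · by_cases h : u = r
    · subst h; simp
    · simp [h]
  · have := h.2.1.nat 0 (by simp)
    simp [this, hR.nG]
  · rintro i s' hi ⟨h1, h2, h3, h4⟩
    have e8 : s'.nat 8 = s.nat 8 := h2.nat 8 (by simp)
    have e10 : s'.nat 10 = mR := by rw [h2.nat 10 (by simp), hmR]
    have e12 : s'.nat 12 = par := by rw [h2.nat 12 (by simp), hpar]
    have e6 : s'.real 6 0 = d := by rw [h2.real 6 (by simp), hd]
    have hback : ∀ u, mL u ≠ 0 → I.col (mL u - 1) = i → mR i = mL u ∧ I.row (mL u - 1) = u := by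
      intro u hu hc
      obtain ⟨-, h6, h7⟩ := hM.left u (mL u - 1) (by omega)
      rw [hc] at h7
      exact ⟨by omega, h6⟩
    -- If column `i` brings no row into the tree, the invariant for rows is the same at `i` and `i +
    -- 1`.
    have keep : (∀ u, mL u ≠ 0 → par i ≠ 0 → I.col (mL u - 1) ≠ i) → ∀ u,
        (if u = r ∨ (mL u ≠ 0 ∧ par (I.col (mL u - 1)) ≠ 0 ∧
          I.col (mL u - 1) < i) then s.real 3 u + d else s.real 3 u) =
        if u = r ∨ (mL u ≠ 0 ∧ par (I.col (mL u - 1)) ≠ 0 ∧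
          I.col (mL u - 1) < i + 1) then s.real 3 u + d else s.real 3 u := by
      intro hno u
      refine if_congr (or_congr_right (and_congr_right fun h5 => and_congr_right fun h6 => ?_))
        rfl rfl
      refine ⟨fun h7 => by omega, fun h7 => ?_⟩
      have := hno u h5
      by_cases h8 : I.col (mL u - 1) = i
      · exact absurd h8 (this (h8 ▸ h6))
      · omega
    have hw (hpi : par i ≠ 0) : ∀ j, Function.update (s'.real 4) i (s'.real 4 i - d) j =
        if par j ≠ 0 ∧ j < i + 1 then s.real 4 j - d else s.real 4 j := by
      intro j
      by_cases hj : j = i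
      · subst hj
        rw [Function.update_self, h3]
        simp [hpi]
      · rw [Function.update_of_ne hj, h3]
        exact if_congr (and_congr_right fun _ => by omega) rfl rfl
    simp only [wp_ite, wp_skip, wp_seq, wp_setReal, Test.Holds, NExpr.eval, RExpr.eval, NExpr.time,
      RExpr.time, Test.time, h1, e12, e6, Memory.setReal_nat, e8, e10, Memory.setNat_nat,
      Memory.setNat_real, Memory.setReal_real, Nat.reduceEqDiff, reduceIte, Function.update_self,
      true_and]
    refine ⟨fun h5 => ⟨by omega, h2.setNat (by simp) _ _, fun j => ?_, fun u => ?_⟩,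
      fun h5 => ⟨by omega, fun h6 => ?_, fun h6 => ?_⟩⟩
    · rw [h3]
      refine if_congr (and_congr_right fun h6 => ?_) rfl rfl
      have : j ≠ i := by rintro rfl; omega
      omega
    · rw [h4]
      exact keep (fun u h6 h7 => absurd h7 (by omega)) u
    · refine ⟨by omega, ?_, fun j => ?_, fun u => ?_⟩
      · exact (h2.setReal (by simp) _ _).setNat (by simp) _ _
      · exact hw (by omega) j
      · rw [h4]
        refine keep (fun u h7 h8 h9 => ?_) u
        have := hback u h7 h9
        omega
    · obtain ⟨h7, h8, h9⟩ := hM.right i (mR i - 1) (by omega)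
      have hne : I.row (mR i - 1) ≠ r := by
        intro h10
        have := (hM.zero _).2 h10.ge
        omega
      have hrow := I.row_lt _ h7
      rw [hR.row _ h7]
      refine ⟨by omega, by omega, ?_, fun j => ?_, fun u => ?_⟩
      · exact ((h2.setReal (by simp) _ _).setReal (by simp) _ _).setNat (by simp) _ _
      · exact hw (by omega) j
      · by_cases hu : u = I.row (mR i - 1)
        · subst hu
          rw [Function.update_self, h4, if_neg, if_pos]
          · refine .inr ⟨by omega, ?_, ?_⟩ <;> rw [h9, Nat.add_sub_cancel, h8]
            · omega
            · omega
          · rintro (h10 | ⟨-, -, h10⟩)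
            · exact hne h10
            · rw [h9, Nat.add_sub_cancel, h8] at h10
              omega
        · rw [Function.update_of_ne hu, h4]
          refine if_congr (or_congr_right (and_congr_right fun h10 => and_congr_right
            fun _ => ?_)) rfl rfl
          have : I.col (mL u - 1) ≠ i := by
            intro h11
            have := hback u h10 h11
            rw [this.1] at hu
            exact hu this.2.symm
          omega
  · rintro t s' ⟨h1, h2, h3, h4⟩ ht
    refine ⟨h2, fun u => ?_, fun j hj => ?_, ?_⟩
    · rw [h4, AssignmentProblem.effU]
      refine if_congr (or_congr_right (and_congr_right fun h5 => ?_)) rfl rfl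
      obtain ⟨h6, -⟩ := hM.left u (mL u - 1) (by omega)
      have := I.col_lt _ h6
      simp [this]
    · rw [h3, AssignmentProblem.effW]
      by_cases h : par j = 0 <;> simp [h, hj]
    · simp only [NExpr.time] at ht
      omega

/-- Change the matching along the path through which the column in `20` was reached. -/
def augment : Program :=
  .seq (.setNat 22 (.const 0) (.const 1))
    (.while (.natLe (.const 1) (.var 22))
      (.seq (.setNat 16 (.const 0) (.get 12 (.var 20)))
        (.seq (.setNat 15 (.const 0) (.get 8 (.sub (.var 16) (.const 1))))
          (.seq (.setNat 22 (.const 0) (.get 11 (.var 15)))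
            (.seq (.setNat 11 (.var 15) (.var 16))
              (.seq (.setNat 10 (.var 20) (.var 16))
                (.setNat 20 (.const 0) (.get 3 (.sub (.var 22) (.const 1))))))))))

/-- The rank of the current column drops in each round, so it bounds the number of rounds. -/
theorem wp_augment {I : AssignmentProblem} {L W r n : ℕ} (hF : I.Fits L W)
    {s : Memory} (hR : I.Ready s) {ord : ℕ → ℕ} {yu yw : ℕ → ℝ}
    (hA : I.Augmenting r (s.nat 11) (s.nat 10) (s.nat 12) ord yu yw (s.nat 20 0))
    (hfeas : ∀ k, k < I.m → I.row k < r + 1 → yu (I.row k) + yw (I.col k) ≤ I.cost k)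
    (hnonpos : ∀ j, j < I.nG → yw j ≤ 0) (hn : ord (s.nat 20 0) ≤ n) :
    WP W augment s fun t s' => s.Agree [10, 11, 15, 16, 20, 22] [] s' ∧
      I.Matching (r + 1) (s'.nat 11) (s'.nat 10) ∧
      I.Dual (r + 1) (s'.nat 11) (s'.nat 10) yu yw ∧ t ≤ 100 * (n + 2) := by
  have hm := hF.one_le
  have hW := hF.le
  simp only [augment, wp_seq, wp_setNat, NExpr.eval, NExpr.time]
  refine ⟨by omega, by omega, WP.while (n := 100 * (ord (s.nat 20 0) + 1)) (fun N s' =>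
    s.Agree [10, 11, 15, 16, 20, 22] [] s' ∧
    ((s'.nat 22 0 ≠ 0 ∧
      I.Augmenting r (s'.nat 11) (s'.nat 10) (s.nat 12) ord yu yw (s'.nat 20 0) ∧
      N = 100 * (ord (s'.nat 20 0) + 1)) ∨
    (s'.nat 22 0 = 0 ∧ I.Matching (r + 1) (s'.nat 11) (s'.nat 10) ∧
      I.Dual (r + 1) (s'.nat 11) (s'.nat 10) yu yw)))
    ⟨(Memory.Agree.refl _ _ _).setNat (by simp) _ _, .inl ⟨by simp, by simpa using hA,
      by simp⟩⟩ ?_ ?_⟩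
  · rintro N s₁ ⟨hA₁, h⟩ hb
    simp only [Test.Holds, NExpr.eval] at hb
    rcases h with ⟨-, h, rfl⟩ | ⟨h, -⟩
    · have hR₁ : I.Ready s₁ := hR.agree hA₁
      have e12 : s₁.nat 12 = s.nat 12 := hA₁.nat 12 (by simp)
      have hreach := h.reached
      set j := s₁.nat 20 0 with hj
      obtain ⟨k, hk⟩ : ∃ k, s.nat 12 j = k + 1 := ⟨s.nat 12 j - 1, by omega⟩
      obtain ⟨hkm, hcol, -, -⟩ := h.through j k hk
      have hc := I.col_lt k hkm
      have hr := I.row_lt k hkm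
      -- In the last round the row is unmatched and truncated subtraction yields edge `0`. Its
      -- column is stored but plays no further role; `1 ≤ m` keeps it in range.
      have hmL : s₁.nat 11 (I.row k) - 1 < I.m := by
        rcases hq : s₁.nat 11 (I.row k) with - | q
        · omega
        · exact (h.left _ q hq).1
      have hc₂ := I.col_lt _ hmL
      simp [← hj, e12, hk, hR₁.row k hkm, hR₁.col _ hmL]
      refine ⟨by omega, by omega, by omega, by omega, by omega, by omega, by omega, by omega, ?_⟩
      have hA₂ : s.Agree [10, 11, 15, 16, 20, 22] []
          ((((((s₁.setNat 16 0 (k + 1)).setNat 15 0 (I.row k)).setNat 22 0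
            (s₁.nat 11 (I.row k))).setNat 11 (I.row k) (k + 1)).setNat 10 j (k + 1)).setNat 20 0
              (I.col (s₁.nat 11 (I.row k) - 1))) := by
        refine .setNat (.setNat (.setNat (.setNat (.setNat (hA₁.setNat ?_ _ _) ?_ _ _) ?_ _ _)
          ?_ _ _) ?_ _ _) ?_ _ _
        all_goals simp
      by_cases h0 : s₁.nat 11 (I.row k) = 0
      · obtain ⟨h1, h2⟩ := h.last hk h0 hfeas hnonpos
        exact ⟨0, ⟨hA₂, .inr ⟨h0, h1, h2⟩⟩, by omega⟩
      · obtain ⟨h1, h2⟩ := h.next hk h0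
        exact ⟨_, ⟨hA₂, .inl ⟨h0, h1, rfl⟩⟩, by omega⟩
    · omega
  · rintro N s' t ⟨hA', h⟩ hb ht
    simp only [Test.Holds, NExpr.eval, Test.time, NExpr.time] at hb ht
    rcases h with ⟨h, -⟩ | ⟨-, h1, h2⟩
    · omega
    · exact ⟨hA', h1, h2, by omega⟩

/-! ### One phase -/

/-- Add the row in `18` to the matching, or set `19` to `2` if this is impossible. -/
def phase : Program :=
  .seq (forRange (.mul (.const 2) (.get 0 (.const 3))) (.setNat 9 (.var 21) (.const 0)))
    (.seq (forRange (.get 0 (.const 2)) (.setNat 12 (.var 21) (.const 0)))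
      (.seq (.setNat 15 (.const 0) (.var 18))
        (.seq (.setNat 19 (.const 0) (.const 0))
          (.seq pushEdges
            (.seq search
              (.ite (.natLe (.var 19) (.const 1))
                (.seq dualUpdate
                  (.seq augment (.setNat 18 (.const 0) (.add (.var 18) (.const 1)))))
                .skip))))))

/-- The state between two phases, after the rows below `r` were matched. -/
structure AssignmentProblem.Matched (I : AssignmentProblem) (r : ℕ) (s : Memory) : Prop where
  ready : I.Ready s
  matching : I.Matching r (s.nat 11) (s.nat 10)
  dual : I.Dual r (s.nat 11) (s.nat 10) (s.real 3) (s.real 4)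
  outside : ∀ j, I.nG ≤ j → s.nat 12 j = 0

theorem countEdges_le (row : ℕ → ℕ) (u q : ℕ) : countEdges row u q ≤ q := by
  induction q with
  | zero => simp [countEdges]
  | succ q ih => simp only [countEdges]; split_ifs <;> omega

theorem AssignmentProblem.reached_le (I : AssignmentProblem) (par : ℕ → ℕ) :
    I.reached par ≤ I.nG :=
  (Finset.card_filter_le _ _).trans (by simp)

theorem wp_phase {I : AssignmentProblem} {L W r : ℕ} (hF : I.Fits L W) (hr : r < I.R)
    {s : Memory} (hI : I.Matched r s) (h18 : s.nat 18 0 = r) :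
    WP W phase s fun t s' =>
      s.Agree [9, 10, 11, 12, 15, 16, 17, 18, 19, 20, 21, 22, 23] [3, 4, 5, 6] s' ∧
      ((s'.nat 19 0 = 1 ∧ s'.nat 18 0 = r + 1 ∧ I.Matched (r + 1) s') ∨
        (s'.nat 19 0 = 2 ∧ ∀ f, ¬ I.Assigns f)) ∧
      t ≤ (80 * L + 500) * (4 * I.m + 4) + 300 * (I.nG + 2) := by
  have hm := hF.one_le
  have hW := hF.le
  obtain ⟨hR, hM, hD, hout⟩ := hI
  rw [phase, wp_seq]
  refine (wp_clear (n := 2 * I.m) (by simp) (by omega) fun s' hs' => ?_).mono ?_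
  · simp [hs'.nat 0 (by simp), hR.m]
  rintro t₁ s₁ ⟨hz₁, -, hA₁, ht₁⟩
  rw [wp_seq]
  refine (wp_clear (n := I.nG) (by simp) (by omega) fun s' hs' => ?_).mono ?_
  · simp [hs'.nat 0 (by simp), hA₁.nat 0 (by simp), hR.nG]
  rintro t₂ s₂ ⟨hz₂, hz₂', hA₂, ht₂⟩
  have hz₁ : ∀ i, i < 2 * I.m → s₂.nat 9 i = 0 := by
    rw [hA₂.nat 9 (by simp)]; exact hz₁
  have hA₂ : s.Agree [9, 12, 21] [] s₂ :=
    (hA₁.mono (by simp) (by simp)).trans (hA₂.mono (by simp) (by simp))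
  -- Only the cells of actual columns are cleared; `outside` covers the rest.
  have hz₂ : ∀ j, s₂.nat 12 j = 0 := by
    intro j
    rcases Nat.lt_or_ge j I.nG with h | h
    · exact hz₂ j h
    · rw [hz₂' j h, hA₁.nat 12 (by simp)]
      exact hout j h
  rw [wp_seq, wp_setNat]
  have e18 : s₂.nat 18 0 = r := by rw [hA₂.nat 18 (by simp), h18]
  refine ⟨by simp, by simp [e18]; omega, ?_⟩
  rw [wp_seq, wp_setNat]
  refine ⟨by simp, by simp, ?_⟩
  simp only [NExpr.eval, NExpr.time, e18]
  obtain ⟨s₃, hs₃⟩ : ∃ s₃, s₃ = (s₂.setNat 15 0 r).setNat 19 0 0 := ⟨_, rfl⟩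
  rw [← hs₃]
  have hA₃ : s.Agree [9, 12, 15, 19, 21] [] s₃ := by
    rw [hs₃]
    exact ((hA₂.mono (by simp) (by simp)).setNat (by simp) _ _).setNat (by simp) _ _
  have e15 : s₃.nat 15 0 = r := by simp [hs₃]
  have e9 : s₃.nat 9 = s₂.nat 9 := by simp [hs₃]
  have e12 : s₃.nat 12 = s₂.nat 12 := by simp [hs₃]
  have e19 : s₃.nat 19 0 = 0 := by simp [hs₃]
  rw [wp_seq]
  refine (wp_pushEdges hF (hR.agree hA₃) e15 hr
    (.of_zero _ _ (by rw [e9]; exact hz₁)) fun k hk _ => ?_).mono ?_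
  · rw [e9]; exact hz₁ _ (by omega)
  rintro t₄ s₄ ⟨hT, htr, hkey, hA₄, ht₄⟩
  have hc := Nat.mul_le_mul_left (80 * L + 100) (countEdges_le I.row r I.m)
  have hS : I.Searching r s₄ := by
    have f12 : s₄.nat 12 = s₂.nat 12 := by rw [hA₄.nat 12 (by simp), e12]
    have f11 : s₄.nat 11 = s.nat 11 := by rw [hA₄.nat 11 (by simp), hA₃.nat 11 (by simp)]
    have f10 : s₄.nat 10 = s.nat 10 := by rw [hA₄.nat 10 (by simp), hA₃.nat 10 (by simp)]
    have f3 : s₄.real 3 = s.real 3 := by rw [hA₄.real 3 (by simp), hA₃.real 3 (by simp)]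
    have f4 : s₄.real 4 = s.real 4 := by rw [hA₄.real 4 (by simp), hA₃.real 4 (by simp)]
    rw [hA₃.real 3 (by simp), hA₃.real 4 (by simp)] at hkey
    constructor
    · rw [f10, f11, f12, f3, f4]
      obtain ⟨d, hd⟩ := AssignmentProblem.Search.start hM hD hz₂
      exact ⟨d, _, hd⟩
    · rw [f10, f11, f12, f3, f4]
      refine .start hz₂ hT (fun k hk => ?_) fun k hk hkr => ?_
      · rw [htr k hk, e9, hz₁ _ (by omega)]
      · rw [hkey k hk, if_pos hkr]
  have hA₄ : s.Agree [9, 12, 15, 16, 17, 19, 21] [5] s₄ :=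
    (hA₃.mono (by simp) (by simp)).trans (hA₄.mono (by simp) (by simp))
  have e19 : s₄.nat 19 0 = 0 := by
    have := ‹s₃.Agree [9, 16, 17] [5] s₄›.nat 19 (by simp)
    rw [this, e19]
  rw [wp_seq]
  refine (wp_search hF hr (hR.agree hA₄) hS e19).mono ?_
  rintro t₅ s₅ ⟨hA₅, ht₅, h⟩
  have hA₅ : s.Agree [9, 12, 15, 16, 17, 19, 20, 21, 23] [3, 4, 5, 6] s₅ :=
    (hA₄.mono (by simp) (by simp)).trans (hA₅.mono (by simp) (by simp))
  have htime : ∀ t₆, t₆ ≤ 100 * (I.nG + 1) + 100 * (I.nG + 2) + 50 →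
      t₁ + (t₂ + (1 + (1 + 1) + 1 + (1 + 1 + 1 + (t₄ + (t₅ + t₆))))) ≤
        (80 * L + 500) * (4 * I.m + 4) + 300 * (I.nG + 2) := by
    intro t₆ h₆
    simp only [NExpr.time] at ht₁ ht₂
    simp only [Nat.mul_add, Nat.add_mul, Nat.mul_assoc] at *
    rw [Nat.mul_left_comm L 4 I.m]
    rw [Nat.mul_left_comm L 2 I.m] at ht₅
    omega
  rw [wp_ite]
  rcases h with ⟨h19, hFd⟩ | ⟨h19, hno⟩
  · refine ⟨fun _ => ?_, fun hb => absurd hb (by simp [h19])⟩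
    obtain ⟨⟨ord, hS₅⟩, hreach, hfree⟩ := hFd
    rw [wp_seq]
    refine (wp_dualUpdate hF hr (hR.agree hA₅) hS₅.matching
      (by rw [hA₅.nat 18 (by simp), h18])).mono ?_
    rintro t₆ s₆ ⟨hA₆, hyu, hyw, ht₆⟩
    have hord := (hS₅.ord_lt _ hreach).le.trans (I.reached_le _)
    have hR₆ : I.Ready s₆ := (hR.agree hA₅).agree hA₆
    have haug := hS₅.augmenting hreach hfree
    have f12 : s₆.nat 12 = s₅.nat 12 := hA₆.nat 12 (by simp)
    rw [wp_seq]
    refine (wp_augment hF hR₆ (n := I.nG) (by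
      rw [hA₆.nat 11 (by simp), hA₆.nat 10 (by simp), f12, hA₆.nat 20 (by simp)]
      exact haug) hS₅.dual.feas hS₅.dual.nonpos (by rw [hA₆.nat 20 (by simp)]; exact hord)).mono ?_
    rintro t₇ s₇ ⟨hA₇, hM₇, hD₇, ht₇⟩
    have e18 : s₇.nat 18 0 = r := by
      rw [hA₇.nat 18 (by simp), hA₆.nat 18 (by simp), hA₅.nat 18 (by simp), h18]
    rw [wp_setNat]
    simp only [NExpr.eval, e18, NExpr.time, Test.time]
    have hAall : s.Agree [9, 10, 11, 12, 15, 16, 17, 18, 19, 20, 21, 22, 23] [3, 4, 5, 6]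
        (s₇.setNat 18 0 (r + 1)) :=
      (((hA₅.mono (by simp) (by simp)).trans (hA₆.mono (by simp) (by simp))).trans
        (hA₇.mono (by simp) (by simp))).setNat (by simp) _ _
    refine ⟨by omega, by omega, hAall, .inl ⟨?_, by simp, ⟨hR.agree hAall, ?_, ?_, ?_⟩⟩, ?_⟩
    · simp [hA₇.nat 19 (by simp), hA₆.nat 19 (by simp), h19]
    · simpa using hM₇
    · simp only [Memory.setNat_nat, Memory.setNat_real, Nat.reduceEqDiff, reduceIte]
      rw [hA₇.real 3 (by simp), hA₇.real 4 (by simp)]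
      exact hD₇.congr (fun u hu => (hM₇.zero u).2 hu) (fun u _ => hyu u) hyw
    · intro j hj
      simp only [Memory.setNat_nat, Nat.reduceEqDiff, reduceIte]
      rw [hA₇.nat 12 (by simp), f12]
      by_contra h0
      obtain ⟨h1, h2, -⟩ := hS₅.through j (s₅.nat 12 j - 1) (by omega)
      have := I.col_lt _ h1
      omega
    · have := htime _ (show 1 + 1 + 1 + 1 + (t₆ + (t₇ + (1 + (1 + 1 + 1 + 1) + 1))) + 1 ≤ _
        by omega)
      omega
  · refine ⟨fun hb => absurd hb (by simp [h19]), fun _ => ?_⟩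
    simp only [wp_skip]
    refine ⟨hA₅.mono (by simp) (by simp), .inr ⟨h19, hno⟩, ?_⟩
    have := htime _ (show 1 + 1 + 1 + 1 + 1 + 1 ≤ _ by omega)
    simp only [Test.time, NExpr.time]
    omega

/-! ### Preparation, output and the complete algorithm -/

/-- The memory holds the assignment problem `I` as in the input. -/
structure AssignmentProblem.Loaded (I : AssignmentProblem) (s : Memory) : Prop where
  R : s.nat 0 0 = I.R
  nG : s.nat 0 2 = I.nG
  m : s.nat 0 3 = I.m
  row : ∀ k, k < I.m → s.nat 1 (s.nat 2 k) = I.row k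
  col : ∀ k, k < I.m → s.nat 3 k = I.col k
  cost : ∀ k, k < I.m → s.real 1 k + s.real 0 0 * s.real 2 k = I.cost k
  nat_eq_zero : ∀ k ∈ [4, 5, 6, 10, 11, 12], ∀ i, s.nat k i = 0
  real_eq_zero : ∀ i, s.real 4 i = 0

/-- Compute the rows and the costs of the edges and the adjacency lists. -/
def setup : Program :=
  forRange (.get 0 (.const 3))
    (.seq (.setNat 8 (.var 21) (.get 1 (.get 2 (.var 21))))
      (.seq (.setReal 7 (.var 21)
          (.add (.get 1 (.var 21)) (.mul (.get 0 (.const 0)) (.get 2 (.var 21)))))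
        (.seq (.setNat 7 (.var 21) (.get 6 (.get 8 (.var 21))))
          (.setNat 6 (.get 8 (.var 21)) (.add (.var 21) (.const 1))))))

theorem wp_setup {I : AssignmentProblem} {L W : ℕ} (hF : I.Fits L W) {s : Memory}
    (hs : I.Loaded s) :
    WP W setup s fun t s' => s.Agree [6, 7, 8, 21] [7] s' ∧ I.Ready s' ∧
      t ≤ 100 * (I.m + 1) := by
  have hW := hF.le
  -- The head of the list of `u` is its last edge among the first `i`; it becomes the link of the
  -- next edge of `u`.
  refine WP.forRange (n := I.m) (c := 60) (fun i s' => s'.nat 21 0 = i ∧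
    s.Agree [6, 7, 8, 21] [7] s' ∧
    (∀ k, k < i → s'.nat 8 k = I.row k ∧ s'.real 7 k = I.cost k ∧
      s'.nat 7 k = lastEdge I.row (I.row k) k) ∧
    ∀ u, s'.nat 6 u = lastEdge I.row u i)
    ⟨by simp, (Memory.Agree.refl _ _ _).setNat (by simp) _ _, by simp, fun u => ?_⟩
    (fun i s' h => ⟨h.1, ?_⟩) (by omega) ?_ ?_
  · simp [hs.nat_eq_zero 6 (by simp), lastEdge]
  · simp [h.2.1.nat 0 (by simp), hs.m]
  · rintro i s' hi ⟨h1, h2, h3, h4⟩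
    have hr := I.row_lt i hi
    have hle := lastEdge_le I.row (I.row i) i
    have e0 := h2.real 0 (by simp)
    have e1 := h2.real 1 (by simp)
    have e2 := h2.real 2 (by simp)
    simp [h1, h2.nat 1 (by simp), h2.nat 2 (by simp), hs.row i hi, e0, e1, e2, hs.cost i hi, h4]
    refine ⟨by omega, by omega, by omega, by omega, by omega, by omega, ?_, fun k hk => ?_, fun u => ?_⟩
    · refine .setNat (.setNat (.setNat (.setReal (h2.setNat ?_ _ _) ?_ _ _) ?_ _ _) ?_ _ _) ?_ _ _
      all_goals simp
    · rcases hk.lt_or_eq with hk | rfl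
      · obtain ⟨h5, h6, h7⟩ := h3 k hk
        simp [Function.update_of_ne hk.ne, h5, h6, h7]
      · simp
    · rw [Function.update_apply, h4, lastEdge]
      by_cases hu : u = I.row i
      · subst hu; simp
      · rw [if_neg hu, if_neg (Ne.symm hu)]
  · rintro t s' ⟨h1, h2, h3, h4⟩ ht
    refine ⟨h2, ⟨?_, ?_, ?_, fun k hk => (h3 k hk).1, fun k hk => ?_, fun k hk => (h3 k hk).2.1,
      fun u _ => h4 u, fun k hk => (h3 k hk).2.2⟩, ?_⟩
    · rw [h2.nat 0 (by simp)]; exact hs.R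
    · rw [h2.nat 0 (by simp)]; exact hs.nG
    · rw [h2.nat 0 (by simp)]; exact hs.m
    · rw [h2.nat 3 (by simp)]; exact hs.col k hk
    · simp only [NExpr.time] at ht
      omega

/-- Mark the selected edges in the output. -/
def writeOutput : Program :=
  .seq (.setNat 5 (.const 0) (.const 1))
    (forRange (.get 0 (.const 0))
      (.setNat 4 (.sub (.get 11 (.var 21)) (.const 1)) (.const 1)))

theorem wp_writeOutput {I : AssignmentProblem} {L W : ℕ} (hF : I.Fits L W) {s : Memory}
    (hR : I.Ready s) (hM : I.Matching I.R (s.nat 11) (s.nat 10)) (h4 : ∀ i, s.nat 4 i = 0) :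
    WP W writeOutput s fun t s' => s'.nat 5 0 = 1 ∧
      (∀ k, k < I.m → s'.nat 4 k = if s.nat 11 (I.row k) = k + 1 then 1 else 0) ∧
      t ≤ 100 * (I.R + 1) := by
  have hW := hF.le
  have hm := hF.one_le
  rw [writeOutput, wp_seq, wp_setNat]
  refine ⟨by simp, by simp; omega, ?_⟩
  refine WP.forRange (n := I.R) (c := 20) (fun i s' => s'.nat 21 0 = i ∧
    s.Agree [4, 5, 21] [] s' ∧ s'.nat 5 0 = 1 ∧
    ∀ k, k < I.m → s'.nat 4 k = if s.nat 11 (I.row k) = k + 1 ∧ I.row k < i then 1 else 0)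
    ⟨by simp, ((Memory.Agree.refl _ _ _).setNat (by simp) _ _).setNat (by simp) _ _, by simp,
      by simp [h4]⟩
    (fun i s' h => ⟨h.1, ?_⟩) (by omega) ?_ ?_
  · simp [h.2.1.nat 0 (by simp), hR.R]
  · rintro i s' hi ⟨h1, h2, h3, h5⟩
    have h0 := (hM.zero i).not.2 (by omega)
    obtain ⟨k, hk⟩ : ∃ k, s.nat 11 i = k + 1 := ⟨s.nat 11 i - 1, by omega⟩
    obtain ⟨hkm, hrow, -⟩ := hM.left i k hk
    simp [h1, h2.nat 11 (by simp), hk]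
    refine ⟨by omega, by omega, (h2.setNat (by simp) _ _).setNat (by simp) _ _, h3,
      fun k' hk' => ?_⟩
    by_cases hkk : k' = k
    · subst hkk
      simp [hrow, hk]
    · rw [Function.update_of_ne hkk, h5 k' hk']
      refine if_congr (and_congr_right fun h6 => ⟨fun h7 => by omega, fun h7 => ?_⟩) rfl rfl
      by_contra h8
      have h9 : I.row k' = i := by omega
      rw [h9, hk] at h6
      omega
  · rintro t s' ⟨h1, h2, h3, h5⟩ ht
    refine ⟨h3, fun k hk => ?_, ?_⟩
    · rw [h5 k hk]
      exact if_congr (and_iff_left (I.row_lt k hk)) rfl rfl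
    · simp only [NExpr.time] at ht ⊢
      omega

/-- The algorithm: the rows are matched one after the other along shortest augmenting paths. -/
def solve : Program :=
  .seq setup
    (.seq (.setNat 18 (.const 0) (.const 0))
      (.seq (.setNat 19 (.const 0) (.const 0))
        (.ite (.natLe (.get 0 (.const 0)) (.get 0 (.const 3)))
          (.seq
            (.while (.conj (.natLe (.var 19) (.const 1))
                (.natLe (.add (.var 18) (.const 1)) (.get 0 (.const 0)))) phase)
            (.ite (.natLe (.var 19) (.const 1)) writeOutput .skip))
          .skip)))

/-- This justifies rejecting an instance with more rows than edges, and so bounding the number of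
phases by the number of edges. -/
theorem AssignmentProblem.Assigns.le {I : AssignmentProblem} {f : ℕ → ℕ} (hf : I.Assigns f) :
    I.R ≤ I.m := by
  have := Finset.card_le_card_of_injOn (s := Finset.range I.R) (t := Finset.range I.m) f
    (fun u hu => by
      simp only [Finset.coe_range, Set.mem_Iio] at hu ⊢
      exact hf.lt u hu)
    (fun u hu u' hu' he => hf.inj u u' (by simpa using hu) (by simpa using hu') (by rw [he]))
  simpa using this

theorem wp_solve {I : AssignmentProblem} {L W : ℕ} (hF : I.Fits L W) {s : Memory}
    (hs : I.Loaded s) :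
    WP W solve s fun t s' =>
      ((s'.nat 5 0 = 1 ∧ ∃ mL mR yu yw, I.Matching I.R mL mR ∧ I.Dual I.R mL mR yu yw ∧
          ∀ k, k < I.m → s'.nat 4 k = if mL (I.row k) = k + 1 then 1 else 0) ∨
        (s'.nat 5 0 = 0 ∧ ∀ f, ¬ I.Assigns f)) ∧
      t ≤ (I.m + 1) * ((80 * L + 500) * (4 * I.m + 4) + 300 * (I.nG + 2) + 400) := by
  have hW := hF.le
  have hm := hF.one_le
  obtain ⟨T, hT⟩ : ∃ T, T = (80 * L + 500) * (4 * I.m + 4) + 300 * (I.nG + 2) := ⟨_, rfl⟩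
  rw [← hT]
  rw [solve, wp_seq]
  refine (wp_setup hF hs).mono ?_
  rintro t₁ s₁ ⟨hA₁, hR₁, ht₁⟩
  rw [wp_seq, wp_setNat]
  refine ⟨by simp, by simp, ?_⟩
  rw [wp_seq, wp_setNat]
  refine ⟨by simp, by simp, ?_⟩
  simp only [NExpr.eval, NExpr.time]
  obtain ⟨s₂, hs₂⟩ : ∃ s₂, s₂ = (s₁.setNat 18 0 0).setNat 19 0 0 := ⟨_, rfl⟩
  rw [← hs₂]
  have hA₂' : s₁.Agree [18, 19] [] s₂ := by
    rw [hs₂]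
    exact ((Memory.Agree.refl _ _ _).setNat (by simp) _ _).setNat (by simp) _ _
  have hA₂ : s.Agree [6, 7, 8, 18, 19, 21] [7] s₂ :=
    (hA₁.mono (by simp) (by simp)).trans (hA₂'.mono (by simp) (by simp))
  have hR₂ : I.Ready s₂ := hR₁.agree hA₂'
  have hzero : ∀ k ∈ [4, 5, 10, 11, 12], ∀ i, s₂.nat k i = 0 := by
    intro k hk i
    have hk' : k ∈ [4, 5, 6, 10, 11, 12] := by
      simp only [List.mem_cons, List.not_mem_nil, or_false] at hk ⊢
      omega
    rw [hA₂.nat k, hs.nat_eq_zero k hk']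
    simp only [List.mem_cons, List.not_mem_nil, or_false] at hk ⊢
    omega
  rw [wp_ite]
  simp only [Test.Holds, NExpr.eval, Test.time, NExpr.time, hR₂.R, hR₂.m, wp_skip]
  refine ⟨fun hRm => ?_, fun hRm => ⟨.inr ⟨hzero 5 (by simp) 0, fun f hf => hRm hf.le⟩, ?_⟩⟩
  · rw [wp_seq]
    refine WP.while (n := (T + 20) * I.R) (fun N s' => s₂.Agree
      [9, 10, 11, 12, 15, 16, 17, 18, 19, 20, 21, 22, 23] [3, 4, 5, 6] s' ∧
      ((∃ r, r ≤ I.R ∧ N = (T + 20) * (I.R - r) ∧ s'.nat 19 0 ≤ 1 ∧ s'.nat 18 0 = r ∧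
        I.Matched r s') ∨
      (s'.nat 19 0 = 2 ∧ ∀ f, ¬ I.Assigns f)))
      ⟨.refl _ _ _, .inl ⟨0, by omega, by simp, by simp [hs₂], by simp [hs₂], hR₂, ?_, ?_, ?_⟩⟩ ?_ ?_
    · refine ⟨fun u k h => ?_, fun u => ?_, fun j k h => ?_⟩
      · rw [hzero 11 (by simp)] at h; omega
      · simp [hzero 11 (by simp)]
      · rw [hzero 10 (by simp)] at h; omega
    -- Before any row is admitted, zero column variables suffice and row variables are irrelevant.
    · have h4 : ∀ i, s₂.real 4 i = 0 := by
        intro i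
        rw [hA₂.real 4 (by simp), hs.real_eq_zero]
      refine ⟨fun k hk h => by omega, fun k hk h => ?_, fun j hj => (h4 j).le, fun j _ _ => h4 j⟩
      rw [hzero 11 (by simp)] at h; omega
    · exact fun j _ => hzero 12 (by simp) j
    · rintro N s' ⟨hA, h⟩ hb
      have hR' : I.Ready s' := hR₂.agree hA
      simp only [Test.Holds, NExpr.eval, hR'.R] at hb
      rcases h with ⟨r, hr, rfl, h19, h18, hI⟩ | ⟨h19, -⟩
      · refine (wp_phase hF (by omega) hI h18).mono ?_
        rintro t s'' ⟨hA', h, ht⟩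
        rw [← hT] at ht
        refine ⟨(T + 20) * (I.R - (r + 1)), ⟨hA.trans hA', ?_⟩, ?_⟩
        · rcases h with ⟨h1, h2, h3⟩ | h
          · exact .inl ⟨r + 1, by omega, rfl, by omega, h2, h3⟩
          · exact .inr h
        · obtain ⟨q, hq⟩ : ∃ q, I.R - r = q + 1 := ⟨I.R - r - 1, by omega⟩
          have hq' : I.R - (r + 1) = q := by omega
          rw [hq, hq', Nat.mul_succ]
          simp only [Test.time, NExpr.time]
          omega
      · omega
    · rintro N s' t ⟨hA, h⟩ hb ht
      have hR' : I.Ready s' := hR₂.agree hA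
      simp only [Test.Holds, NExpr.eval, hR'.R, Test.time, NExpr.time] at hb ht
      have hTm := Nat.mul_le_mul_left (T + 20) hRm
      have htime : ∀ t', t' ≤ 100 * (I.R + 1) + 10 →
          t₁ + (1 + 1 + 1 + (1 + 1 + 1 + (1 + 1 + (1 + 1) + 1 + (t + t') + 1))) ≤
            (I.m + 1) * (T + 400) := by
        intro t' ht'
        simp only [Nat.mul_add, Nat.add_mul, Nat.mul_comm I.m] at ht hTm ⊢
        omega
      rw [wp_ite]
      rcases h with ⟨r, hr, rfl, h19, h18, hI⟩ | ⟨h19, hno⟩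
      · obtain rfl : r = I.R := by omega
        refine ⟨fun _ => ?_, fun h => absurd h19 h⟩
        refine (wp_writeOutput hF hR' hI.matching fun i => ?_).mono ?_
        · rw [hA.nat 4 (by simp), hzero 4 (by simp)]
        · rintro t' s'' ⟨h1, h2, ht'⟩
          refine ⟨.inl ⟨h1, _, _, _, _, hI.matching, hI.dual, h2⟩, htime _ ?_⟩
          simp only [Test.time, NExpr.time]
          omega
      · refine ⟨fun h => ?_, fun _ => ?_⟩
        · simp only [Test.Holds, NExpr.eval] at h
          omega
        · rw [wp_skip]
          refine ⟨.inr ⟨?_, hno⟩, htime _ ?_⟩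
          · rw [hA.nat 5 (by simp), hzero 5 (by simp)]
          · simp only [Test.time, NExpr.time]
            omega
  · simp only [Nat.mul_add, Nat.add_mul]
    omega

/-! ## Problem 2 as an assignment problem -/

theorem eq_of_sum_le_one {ι : Type*} [DecidableEq ι] {s : Finset ι} {y : ι → ℝ}
    (h01 : ∀ e, y e = 0 ∨ y e = 1) (hs : ∑ e ∈ s, y e ≤ 1) {e e' : ι} (he : e ∈ s)
    (he' : e' ∈ s) (h : y e = 1) (h' : y e' = 1) : e = e' := by
  by_contra hne
  have h1 : ∑ i ∈ {e, e'}, y i ≤ ∑ i ∈ s, y i := by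
    refine Finset.sum_le_sum_of_subset_of_nonneg (by simp [Finset.insert_subset_iff, he, he'])
      fun i _ _ => ?_
    rcases h01 i with h2 | h2 <;> rw [h2]
    exact zero_le_one
  rw [Finset.sum_pair hne, h, h'] at h1
  linarith

namespace Graph

variable (G : Graph)

theorem toArray_apply {α : Type} [Zero α] {n : ℕ} (v : Fin n → α) {k : ℕ} (h : k < n) :
    toArray v k = v ⟨k, h⟩ := dif_pos h

theorem toArray_val {α : Type} [Zero α] {n : ℕ} (v : Fin n → α) (k : Fin n) :
    toArray v k = v k := dif_pos k.2

/-- The assignment problem that arises by merging the vertices of each UAV. -/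
noncomputable def toAssignment (σ : Fin G.numE ≃ G.E) (lam : ℝ) : AssignmentProblem where
  R := G.numUAV
  nG := G.nG
  m := G.numE
  row := toArray fun k => (G.owner (σ k).1.1 : ℕ)
  col := toArray fun k => ((σ k).1.2 : ℕ)
  cost := toArray fun k => G.c (σ k) + lam * G.a (σ k)
  row_lt k hk := by rw [toArray_apply _ hk]; exact Fin.is_lt _
  col_lt k hk := by rw [toArray_apply _ hk]; exact Fin.is_lt _

theorem loaded_input (σ : Fin G.numE ≃ G.E) (lam B : ℝ) :
    (G.toAssignment σ lam).Loaded (G.input σ lam B) where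
  R := rfl
  nG := rfl
  m := rfl
  row k hk := by
    change k < G.numE at hk
    simp [input, toAssignment, toArray, hk]
  col k hk := rfl
  cost k hk := by
    change k < G.numE at hk
    simp [input, toAssignment, toArray, hk]
  nat_eq_zero k hk i := by
    simp only [List.mem_cons, List.not_mem_nil, or_false] at hk
    rcases hk with rfl | rfl | rfl | rfl | rfl | rfl <;> rfl
  real_eq_zero i := rfl

variable {G} {σ : Fin G.numE ≃ G.E} {lam : ℝ}

/-- The incidence vector of the edges that are selected by `f`. -/
def incidence (σ : Fin G.numE ≃ G.E) (f : ℕ → ℕ) (e : G.E) : ℝ :=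
  if f (G.owner e.1.1) = (σ.symm e : ℕ) then 1 else 0

theorem row_symm (e : G.E) : (G.toAssignment σ lam).row (σ.symm e) = G.owner e.1.1 := by
  simp [toAssignment, toArray_val]

theorem col_symm (e : G.E) : (G.toAssignment σ lam).col (σ.symm e) = e.1.2 := by
  simp [toAssignment, toArray_val]

theorem cost_symm (e : G.E) :
    (G.toAssignment σ lam).cost (σ.symm e) = G.c e + lam * G.a e := by
  simp [toAssignment, toArray_val]

theorem exists_edge {f : ℕ → ℕ} (hf : (G.toAssignment σ lam).Assigns f) (r : Fin G.numUAV) :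
    ∃ e : G.E, f r = (σ.symm e : ℕ) ∧ G.owner e.1.1 = r := by
  have h1 : f r < G.numE := hf.lt r r.2
  have h2 := hf.row r r.2
  refine ⟨σ ⟨f r, h1⟩, by simp, Fin.ext ?_⟩
  rw [← row_symm (σ := σ) (lam := lam), Equiv.symm_apply_apply]
  exact h2

/-- Within the class of `r` the incidence vector is supported on the single edge `e₀`. Weight one
gives the UAV constraint, the edge costs give the objective. -/
theorem sum_incidence {f : ℕ → ℕ} (w : G.E → ℝ)
    (r : Fin G.numUAV) {e₀ : G.E} (h : f r = (σ.symm e₀ : ℕ)) (h' : G.owner e₀.1.1 = r) :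
    ∑ e : G.E with G.owner e.1.1 = r, w e * incidence σ f e = w e₀ := by
  rw [Finset.sum_eq_single e₀]
  · rw [incidence, h', if_pos h, mul_one]
  · intro e he hne
    rw [Finset.mem_filter] at he
    rw [incidence, he.2, if_neg, mul_zero]
    rw [h]
    exact fun h2 => hne (σ.symm.injective (Fin.ext h2)).symm
  · simp [h']

theorem feasible_incidence {f : ℕ → ℕ} (hf : (G.toAssignment σ lam).Assigns f) :
    G.Feasible (incidence σ f) where
  uav r := by
    obtain ⟨e, h, h'⟩ := exists_edge hf r
    simpa using sum_incidence (fun _ => 1) r h h'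
  ugv j := by
    simp only [incidence]
    rw [Finset.sum_boole]
    norm_cast
    rw [Finset.card_le_one]
    simp only [Finset.mem_filter, Finset.mem_univ, true_and]
    rintro e ⟨h1, h2⟩ e' ⟨h3, h4⟩
    have h5 := hf.inj (G.owner e.1.1) (G.owner e'.1.1) (Fin.is_lt _) (Fin.is_lt _) (by
      rw [h2, h4, col_symm, col_symm, h1, h3])
    rw [h5, h4] at h2
    exact (σ.symm.injective (Fin.ext h2)).symm
  integral e := by
    rw [incidence]
    split_ifs <;> simp

theorem objective_incidence {f : ℕ → ℕ} (hf : (G.toAssignment σ lam).Assigns f) (B : ℝ) :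
    G.objective lam B (incidence σ f) =
      ∑ u ∈ Finset.range G.numUAV, (G.toAssignment σ lam).cost (f u) - lam * B := by
  have h1 : G.objective lam B (incidence σ f) =
      ∑ e, (G.c e + lam * G.a e) * incidence σ f e - lam * B := by
    simp only [objective, add_mul, Finset.sum_add_distrib, mul_sub, Finset.mul_sum, mul_assoc]
    ring
  rw [h1, ← Finset.sum_fiberwise Finset.univ (fun e : G.E => G.owner e.1.1), Finset.sum_range]
  congr 1
  refine Finset.sum_congr rfl fun r _ => ?_
  obtain ⟨e, h, h'⟩ := exists_edge hf r
  rw [sum_incidence _ r h h', h, cost_symm]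

/-- The UAV constraint provides exactly one edge of value one per UAV, and the constraint at `V_g`
makes the columns of these edges distinct. -/
theorem Feasible.exists_assigns {y : G.E → ℝ} (hy : G.Feasible y) (σ : Fin G.numE ≃ G.E)
    (lam : ℝ) : ∃ f, (G.toAssignment σ lam).Assigns f ∧ y = incidence σ f := by
  have h1 : ∀ r : Fin G.numUAV, ∃ e : G.E, G.owner e.1.1 = r ∧ y e = 1 := by
    intro r
    by_contra! h
    have h2 : ∑ e : G.E with G.owner e.1.1 = r, y e = 0 := by
      refine Finset.sum_eq_zero fun e he => ?_
      exact (hy.integral e).resolve_right (h e (Finset.mem_filter.1 he).2)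
    rw [hy.uav r] at h2
    exact one_ne_zero h2
  choose g hg hg' using h1
  obtain ⟨f, key⟩ : ∃ f : ℕ → ℕ, ∀ r : Fin G.numUAV, f r = (σ.symm (g r) : ℕ) :=
    ⟨fun u => if h : u < G.numUAV then (σ.symm (g ⟨u, h⟩) : ℕ) else 0, fun r => dif_pos r.2⟩
  refine ⟨f, ⟨fun u hu => ?_, fun u hu => ?_, fun u u' hu hu' h => ?_⟩, ?_⟩
  · exact (key ⟨u, hu⟩).trans_lt (Fin.is_lt _)
  · rw [show f u = _ from key ⟨u, hu⟩, row_symm, hg]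
  · rw [show f u = _ from key ⟨u, hu⟩, show f u' = _ from key ⟨u', hu'⟩, col_symm, col_symm] at h
    have h3 := eq_of_sum_le_one hy.integral (hy.ugv (g ⟨u, hu⟩).1.2)
      (e := g ⟨u, hu⟩) (e' := g ⟨u', hu'⟩) (by simp) (by simp [Fin.ext h]) (hg' _) (hg' _)
    have h4 := congrArg (fun e : G.E => (G.owner e.1.1 : ℕ)) h3
    simpa [hg] using h4
  · funext e
    rw [incidence, key]
    by_cases h : y e = 1
    · have h3 := eq_of_sum_le_one hy.integral (hy.uav (G.owner e.1.1)).le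
        (e := e) (e' := g (G.owner e.1.1)) (by simp) (by simp [hg]) h (hg' _)
      rw [if_pos (by rw [← h3]), h]
    · rw [if_neg, (hy.integral e).resolve_right h]
      intro h3
      have h4 := σ.symm.injective (Fin.ext h3)
      exact h (h4 ▸ hg' _)

/-- An optimal matching gives a correct answer. -/
theorem answer_of_matching (B : ℝ) {s : Memory} {mL mR : ℕ → ℕ} {yu yw : ℕ → ℝ}
    (h5 : s.nat 5 0 = 1) (hM : (G.toAssignment σ lam).Matching G.numUAV mL mR)
    (hD : (G.toAssignment σ lam).Dual G.numUAV mL mR yu yw)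
    (h4 : ∀ k, k < G.numE →
      s.nat 4 k = if mL ((G.toAssignment σ lam).row k) = k + 1 then 1 else 0) :
    G.Answer σ lam B s := by
  have hf := AssignmentProblem.Matching.assigns hM
  have hout : G.output σ s = incidence σ fun u => mL u - 1 := by
    funext e
    rw [output, h4 _ (Fin.is_lt _), row_symm, incidence]
    have := (hM.zero (G.owner e.1.1)).not.2 (by have := (G.owner e.1.1).2; omega)
    push_cast
    exact if_congr (by omega) rfl rfl
  refine .inl ⟨h5, hout ▸ feasible_incidence hf, fun y hy => ?_⟩
  obtain ⟨f, hf', rfl⟩ := hy.exists_assigns σ lam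
  have h1 := hD.le_cost rfl hf'
  have h2 := AssignmentProblem.Dual.cost_eq hD hM
  rw [hout, objective_incidence hf, objective_incidence hf']
  change ∑ u ∈ Finset.range G.numUAV, _ = _ at h2
  change _ ≤ ∑ u ∈ Finset.range G.numUAV, _ at h1
  linarith

/-! ### The time bound -/

/-- From `log 2 ≥ 1 / 2` follow `log V ≥ 1 / 2` and `L ≤ 8 * log V`, so additive constants are
absorbed by `log V`, `m` and `V`. -/
theorem time_le {m V n L : ℕ} (hm : 1 ≤ m) (hV : 2 ≤ V) (hn : n ≤ V)
    (hL : L = 2 * (Nat.log 2 V + 1)) {t : ℕ}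
    (ht : t ≤ (m + 1) * ((80 * L + 500) * (4 * m + 4) + 300 * (n + 2) + 400)) :
    (t : ℝ) ≤ 26240 * (m * Real.log V * (m + V * Real.log V)) := by
  have hlog2 : (1 / 2 : ℝ) ≤ Real.log 2 := by
    have := Real.log_two_gt_d9; linarith
  set l := Real.log V with hl
  have hVr : (2 : ℝ) ≤ V := by exact_mod_cast hV
  have hmr : (1 : ℝ) ≤ m := by exact_mod_cast hm
  have hnr : (n : ℝ) ≤ V := by exact_mod_cast hn
  have hl1 : 1 / 2 ≤ l := hlog2.trans (Real.log_le_log (by norm_num) hVr)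
  have hlogV : (Nat.log 2 V : ℝ) ≤ 2 * l := by
    have h1 : ((2 : ℝ) ^ Nat.log 2 V) ≤ V := by
      exact_mod_cast Nat.pow_log_le_self 2 (by omega)
    have h2 := Real.log_le_log (by positivity) h1
    rw [Real.log_pow] at h2
    nlinarith [Nat.cast_nonneg (α := ℝ) (Nat.log 2 V)]
  have hLr : (L : ℝ) ≤ 8 * l := by
    rw [hL]; push_cast; linarith
  have ht' : (t : ℝ) ≤ (m + 1) * ((80 * L + 500) * (4 * m + 4) + 300 * (n + 2) + 400) := by
    exact_mod_cast ht
  have h1 : (80 * (L : ℝ) + 500) * (4 * m + 4) ≤ (1640 * l) * (8 * m) :=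
    mul_le_mul (by linarith) (by linarith) (by positivity) (by linarith)
  have h2 : (300 * ((n : ℝ) + 2) + 400) ≤ 3200 * (V * l * l) := by
    have h3 : (V : ℝ) * (1 / 2) * (1 / 2) ≤ V * l * l := by gcongr
    linarith
  calc (t : ℝ) ≤ (m + 1) * ((80 * L + 500) * (4 * m + 4) + 300 * (n + 2) + 400) := ht'
    -- The coefficient `3200` is relaxed to `13120 = 1640 * 8` so that both terms share a factor,
    -- and `26240 = 2 * 13120`.
    _ ≤ (2 * m) * ((1640 * l) * (8 * m) + 13120 * (V * l * l)) := by
        refine mul_le_mul (by linarith) ?_ (by positivity) (by linarith)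
        have : 0 ≤ V * l * l := by positivity
        linarith
    _ = 26240 * (m * l * (m + V * l)) := by ring

theorem numUAV_le (G : Graph) : G.numUAV ≤ G.nA := by
  simpa using Fintype.card_le_of_surjective _ G.owner_surjective

/-- There are no parallel edges in `G`; this is what makes the depth of the tournament tree `O(log
|V|)`. -/
theorem numE_le (G : Graph) : G.numE ≤ G.numV ^ 2 := by
  calc G.E.card ≤ Fintype.card (Fin G.nA × Fin G.nG) := Finset.card_le_univ _
    _ = G.nA * G.nG := by simp
    _ ≤ G.numV ^ 2 := by
        rw [sq]
        exact Nat.mul_le_mul (Nat.le_add_right _ _) (Nat.le_add_left _ _)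

theorem solve_correct (G : Graph) (hE : G.E.Nonempty) (σ : Fin G.numE ≃ G.E) (lam B : ℝ) :
    ∃ (t : ℕ) (s : Memory),
      Exec (4 * (G.numV + G.numE) ^ 4) solve (G.input σ lam B) t s ∧ G.Answer σ lam B s ∧
      (t : ℝ) ≤ 26240 * (G.numE * Real.log G.numV * (G.numE + G.numV * Real.log G.numV)) := by
  have hm : 1 ≤ G.numE := hE.card_pos
  obtain ⟨e, -⟩ := hE
  have hA : 0 < G.nA := e.1.pos
  have hG : 0 < G.nG := e.2.pos
  have hV : 2 ≤ G.numV := by rw [numV]; omega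
  have hn : G.nG ≤ G.numV := by rw [numV]; omega
  -- The depth comes from `|E| ≤ |V| ^ 2`. The integers need only a linear bound; the fourth power
  -- gives it the form `K * x ^ K` with `K = 4`.
  have hF : (G.toAssignment σ lam).Fits (2 * (Nat.log 2 G.numV + 1))
      (4 * (G.numV + G.numE) ^ 4) := by
    refine ⟨hm, ?_, ?_⟩
    · calc G.numE ≤ G.numV ^ 2 := G.numE_le
        _ ≤ (2 ^ (Nat.log 2 G.numV + 1)) ^ 2 :=
            Nat.pow_le_pow_left (Nat.lt_pow_succ_log_self (by omega) _).le 2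
        _ = 2 ^ (2 * (Nat.log 2 G.numV + 1)) := by rw [← pow_mul, mul_comm]
    · have h1 : G.numV + G.numE ≤ (G.numV + G.numE) ^ 4 := Nat.le_self_pow (by omega) _
      have h2 := G.numUAV_le
      change 2 * G.numE + G.numUAV + G.nG + 2 ≤ _
      have h3 : G.numV = G.nA + G.nG := rfl
      omega
  obtain ⟨t, s, hex, h, ht⟩ := wp_solve hF (G.loaded_input σ lam B)
  refine ⟨t, s, hex, ?_, time_le hm hV hn rfl ht⟩
  rcases h with ⟨h5, mL, mR, yu, yw, hM, hD, h4⟩ | ⟨h5, hno⟩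
  · exact answer_of_matching B h5 hM hD h4
  · refine .inr ⟨h5, fun ⟨y, hy⟩ => ?_⟩
    obtain ⟨f, hf, -⟩ := hy.exists_assigns σ lam
    exact hno f hf

end Graph

/-! ## Problem 2 as a network flow problem -/

namespace Graph

variable {G : Graph} {lam : ℝ}

theorem sum_arc (p : G.FlowArc → Prop) [DecidablePred p] (f : G.FlowArc → ℕ) :
    ∑ e with p e, f e = ∑ r with p (.inl r), f (.inl r) +
      (∑ i with p (.inr (.inl i)), f (.inr (.inl i)) +
        (∑ e with p (G.edgeArc e), f (G.edgeArc e) +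
          ∑ j with p (.inr (.inr (.inr j))), f (.inr (.inr (.inr j))))) := by
  simp only [Finset.sum_filter, Fintype.sum_sum_type]
  rfl

/-- At each node all but one kind of incoming and one kind of outgoing arc drop out of the sums. The
sink imposes no condition of its own. -/
theorem isFlow_iff {n : ℕ} {f : G.FlowArc → ℕ} : (G.network lam).IsFlow n f ↔
    (∀ e, f e ≤ 1) ∧ ∑ r, f (.inl r) = n ∧
    (∀ r, ∑ i with G.owner i = r, f (.inr (.inl i)) = f (.inl r)) ∧
    (∀ i, ∑ e : G.E with e.1.1 = i, f (G.edgeArc e) = f (.inr (.inl i))) ∧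
    ∀ j, f (.inr (.inr (.inr j))) = ∑ e : G.E with e.1.2 = j, f (G.edgeArc e) := by
  constructor
  · intro h
    refine ⟨h.capacity, ?_, fun r => ?_, fun i => ?_, fun j => ?_⟩
    · have := h.value
      rw [sum_arc, sum_arc] at this
      simpa [network, edgeArc, Finset.filter_eq'] using this
    · have := h.conservation (.uav r) (by simp [network]) (by simp [network])
      rw [sum_arc, sum_arc] at this
      simpa [network, edgeArc, Finset.filter_eq'] using this
    · have := h.conservation (.left i) (by simp [network]) (by simp [network])
      rw [sum_arc, sum_arc] at this
      simpa [network, edgeArc, Finset.filter_eq'] using this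
    · have := h.conservation (.right j) (by simp [network]) (by simp [network])
      rw [sum_arc, sum_arc] at this
      simpa [network, edgeArc, Finset.filter_eq'] using this
  · rintro ⟨h1, h2, h3, h4, h5⟩
    refine ⟨h1, fun v hs hq => ?_, ?_⟩
    · cases v with
      | source => exact absurd rfl hs
      | sink => exact absurd rfl hq
      | uav r =>
        rw [sum_arc, sum_arc]
        simpa [network, edgeArc, Finset.filter_eq'] using h3 r
      | left i =>
        rw [sum_arc, sum_arc]
        simpa [network, edgeArc, Finset.filter_eq'] using h4 i
      | right j =>
        rw [sum_arc, sum_arc]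
        simpa [network, edgeArc, Finset.filter_eq'] using h5 j
    · rw [sum_arc, sum_arc]
      simpa [network, edgeArc] using h2

theorem sum_owner (g : G.E → ℕ) (r : Fin G.numUAV) :
    ∑ i with G.owner i = r, ∑ e : G.E with e.1.1 = i, g e =
      ∑ e : G.E with G.owner e.1.1 = r, g e := by
  rw [← Finset.sum_fiberwise_of_maps_to
    (s := Finset.univ.filter fun e : G.E => G.owner e.1.1 = r)
    (t := Finset.univ.filter fun i => G.owner i = r) (g := fun e => e.1.1) (by simp)]
  refine Finset.sum_congr rfl fun i hi => ?_
  rw [Finset.filter_filter]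
  refine Finset.sum_congr (Finset.filter_congr fun e _ => ?_) fun _ _ => rfl
  rw [Finset.mem_filter] at hi
  exact ⟨fun h => ⟨h ▸ hi.2, h⟩, fun h => h.2⟩

theorem feasible_restrict {f : G.FlowArc → ℕ} (hf : (G.network lam).IsFlow G.numUAV f) :
    G.Feasible (G.restrict f) := by
  obtain ⟨h1, h2, h3, h4, h5⟩ := isFlow_iff.1 hf
  -- The source arcs carry `numUAV` units in total and at most one unit each, so all of them are
  -- saturated.
  have h6 : ∀ r, f (.inl r) = 1 := by
    intro r
    refine (Finset.sum_eq_sum_iff_of_le (fun r _ => h1 (.inl r))).1 ?_ r (Finset.mem_univ r)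
    simpa using h2
  refine ⟨fun r => ?_, fun j => ?_, fun e => ?_⟩
  · have := sum_owner (fun e => f (G.edgeArc e)) r
    simp only [h4, h3, h6] at this
    simp only [restrict]
    exact_mod_cast this.symm
  · simp only [restrict]
    have := h1 (.inr (.inr (.inr j)))
    rw [h5] at this
    exact_mod_cast this
  · simp only [restrict]
    have := h1 (G.edgeArc e)
    interval_cases f (G.edgeArc e) <;> simp

theorem injOn_restrict :
    Set.InjOn G.restrict {f | (G.network lam).IsFlow G.numUAV f} := by
  intro f hf f' hf' h
  obtain ⟨-, -, h3, h4, h5⟩ := isFlow_iff.1 hf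
  obtain ⟨-, -, h3', h4', h5'⟩ := isFlow_iff.1 hf'
  have hE : ∀ e, f (G.edgeArc e) = f' (G.edgeArc e) := by
    intro e
    have := congrFun h e
    simp only [restrict] at this
    exact_mod_cast this
  have hL : ∀ i, f (.inr (.inl i)) = f' (.inr (.inl i)) := by
    intro i
    rw [← h4, ← h4']
    exact Finset.sum_congr rfl fun e _ => hE e
  funext e
  rcases e with r | i | e | j
  · rw [← h3, ← h3']
    exact Finset.sum_congr rfl fun i _ => hL i
  · exact hL i
  · exact hE e
  · rw [h5, h5']
    exact Finset.sum_congr rfl fun e _ => hE e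

theorem surjOn_restrict :
    Set.SurjOn G.restrict {f | (G.network lam).IsFlow G.numUAV f} {x | G.Feasible x} := by
  intro x hx
  obtain ⟨n, hn, hn1⟩ : ∃ n : G.E → ℕ, (∀ e, (n e : ℝ) = x e) ∧ ∀ e, n e ≤ 1 := by
    refine ⟨fun e => if x e = 1 then 1 else 0, fun e => ?_, fun e => ?_⟩
    · rcases hx.integral e with h | h <;> simp [h]
    · dsimp only; split_ifs <;> omega
  have huav : ∀ r, ∑ e : G.E with G.owner e.1.1 = r, n e = 1 := by
    intro r
    have := hx.uav r
    simp only [← hn] at this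
    exact_mod_cast this
  have hugv : ∀ j, ∑ e : G.E with e.1.2 = j, n e ≤ 1 := by
    intro j
    have := hx.ugv j
    simp only [← hn] at this
    exact_mod_cast this
  -- Conservation forces these values. The capacity at `uav r → left i` holds because the edges at
  -- `i` are among those of its UAV, which sum to one.
  refine ⟨fun
    | .inl _ => 1
    | .inr (.inl i) => ∑ e : G.E with e.1.1 = i, n e
    | .inr (.inr (.inl e)) => n e
    | .inr (.inr (.inr j)) => ∑ e : G.E with e.1.2 = j, n e,
    isFlow_iff.2 ⟨?_, by simp, fun r => ?_, fun i => rfl, fun j => rfl⟩, funext hn⟩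
  · rintro (r | i | e | j)
    · exact le_rfl
    · refine le_trans ?_ (huav (G.owner i)).le
      refine Finset.sum_le_sum_of_subset fun e he => ?_
      simp only [Finset.mem_filter, Finset.mem_univ, true_and] at he ⊢
      rw [he]
    · exact hn1 e
    · exact hugv j
  · exact (sum_owner n r).trans (huav r)

theorem objective_restrict (f : G.FlowArc → ℕ) (B : ℝ) :
    G.objective lam B (G.restrict f) = (G.network lam).flowCost f - lam * B := by
  simp only [objective, FlowNetwork.flowCost, Fintype.sum_sum_type, network, restrict, edgeArc,
    zero_mul, Finset.sum_const_zero, zero_add, add_zero, add_mul, Finset.sum_add_distrib, mul_sub,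
    Finset.mul_sum, mul_assoc]
  ring

end Graph

end Rendezvous

theorem mainTheorem5 :
    (∀ (G : Rendezvous.Graph) (lam B : ℝ),
      Set.BijOn G.restrict {f | (G.network lam).IsFlow G.numUAV f} {x | G.Feasible x} ∧
      ∀ f, (G.network lam).IsFlow G.numUAV f →
        G.objective lam B (G.restrict f) = (G.network lam).flowCost f - lam * B) ∧
    (∃ (P : Rendezvous.Program) (C : ℝ) (K : ℕ),
      ∀ (G : Rendezvous.Graph), G.E.Nonempty →
        ∀ (σ : Fin G.numE ≃ G.E) (lam B : ℝ),
          ∃ (t : ℕ) (s : Rendezvous.Memory),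
            Rendezvous.Exec (K * (G.numV + G.numE) ^ K) P (G.input σ lam B) t s ∧
            G.Answer σ lam B s ∧
            (t : ℝ) ≤ C * (G.numE * Real.log G.numV *
              (G.numE + G.numV * Real.log G.numV))) := by
  refine ⟨fun G lam B => ⟨⟨fun f hf => Rendezvous.Graph.feasible_restrict hf,
    Rendezvous.Graph.injOn_restrict, Rendezvous.Graph.surjOn_restrict⟩,
    fun f _ => Rendezvous.Graph.objective_restrict f B⟩, ?_⟩
  exact ⟨Rendezvous.solve, 26240, 4, fun G hE σ lam B =>
    Rendezvous.Graph.solve_correct G hE σ lam B⟩
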